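/- Let $n\ge 1$ parties each be given one von Neumann measurement of a qubit: party $j$ is given only $\theta_j\in[0,2\pi)$ and $\varphi_j\in[-\pi/2,\pi/2]$, which describe the observable $$M_j=\begin{pmatrix}\sin\varphi_j & e^{-i\theta_j}\cos\varphi_j\\ e^{i\theta_j}\cos\varphi_j & -\sin\varphi_j\end{pmatrix}.$$ Let $p(x)=\langle\Psi_n|\bigotimes_{j}\tfrac12(1+x_jM_j)|\Psi_n\rangle$, $x\in\{-1,+1\}^n$, be the joint law of the outcomes when these measurements are performed on $|\Psi_n\rangle=\tfrac1{\sqrt2}(|0^n\rangle+|1^n\rangle)$ (the GHZ distribution). Sequential model: party 1 (the leader) has a private channel with each other party, over which single bits are sent, one at a time. Only the leader can toss (independent, unbiased) coins; the other parties are deterministic, and there is no shared randomness. Write $\theta=\sum_j\theta_j$ and $\lambda=\lceil\log_2 n\rceil$; for $X\in\{-1,+1\}^n$ let $c_j=\cos\big(\tfrac12(\varphi_j-\tfrac\pi2X_j)\big)$, $s_j=-\sin\big(\tfrac12(\varphi_j-\tfrac\pi2X_j)\big)$. Whenever the $r$-bit truncations of a number are requested for successive $r$, a party sends only the digits not yet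 sent. The protocol is the following. 1. *Bernoulli bit.* For $k=1,2,\dots$ the leader tosses a coin $U_k$, puts $U(k)=\sum_{i\le k}U_i2^{-i}$, obtains from every other party the $(k+\lambda)$-bit truncation of $\theta_j/2$ (with three bits for the integer part), and computes from these and from $\theta_1/2$ the corresponding approximation $p(k)$ of $\cos^2(\theta/2)$. If $U(k)\le p(k)-2\cdot2^{-k}$ he sets $B=1$; if $U(k)\ge p(k)+2^{-k}$ he sets $B=0$; otherwise he goes on to $k+1$. After every $k$ he tells the others with one bit each whether he goes on. 2. *Tentative sample.* The leader tosses a coin $S$ and broadcasts it. Every $X_j$ is sampled with $P(X_j=+1)=\cos^2\big(\tfrac12(\varphi_j-\tfrac\pi2)\big)$ by comparing fresh coins with the binary digits of this parameter until they differ; for $j\ge2$ the leader tosses these coins and sends them to party $j$, which answers each with one bit telling whether another is needed. If $S=1$, every party replaces $X_j$ by $-X_j$. 3. *Acceptance test.* For $k=1,2,\dots$ the leader tosses a new coin $U_k$, forms $U(k)$ as before, and obtains from every other party the $(k+3+\lambda)$-bit truncations $\hat c_j,\hat s_j$ of $c_j,s_j$ (one more bit each for the sign). With $a_1=c_1\prod_{j\ge2}\hat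 c_j$ and $a_2=\pm s_1\prod_{j\ge2}\hat s_j$ (sign $+$ if $B=1$, $-$ if $B=0$) he puts $L_k=a_1^2+a_2^2$, $R_k=\tfrac12(a_1+a_2)^2$. If $U(k)L_k-R_k<-4\cdot2^{-k}$, $X$ is accepted; if $U(k)L_k-R_k>4\cdot2^{-k}$, $X$ is rejected; otherwise he goes on to $k+1$. He informs the others of each decision (one bit each: goes on or not; when he stops, one more bit each: accepted or rejected). On rejection the parties return to step 2 (with the same $B$); on acceptance every party $j$ outputs $X_j$. Then for every $n\ge1$ and all measurements, the protocol halts with probability $1$, its output $x\in\{-1,+1\}^n$ is distributed exactly according to $p$, and the expected number of coin tosses is at most $6n+14$. Moreover there is an absolute constant $C$ such that, for every $n\ge1$ and all measurements, the expected total number of bits communicated is at most $Cn^2$. -/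

import Mathlib

noncomputable section

/-! ## Von Neumann measurements on the GHZ state -/

/-- A von Neumann measurement of one qubit, given by its point on the Bloch sphere: azimuthal
angle `θ ∈ [0, 2π)` and elevation angle `φ ∈ [-π/2, π/2]`. -/
structure VNMeasurement where
  θ : ℝ
  φ : ℝ
  hθ : θ ∈ Set.Ico 0 (2 * Real.pi)
  hφ : φ ∈ Set.Icc (-(Real.pi / 2)) (Real.pi / 2)

/-- The observable `x σ₁ + y σ₂ + z σ₃` of the measurement, with `x = cos θ cos φ`,
`y = sin θ cos φ`, `z = sin φ`. -/
def VNMeasurement.observable (M : VNMeasurement) : Matrix (Fin 2) (Fin 2) ℂ :=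
  !![(Real.sin M.φ : ℂ), Complex.exp (-(M.θ * Complex.I)) * Real.cos M.φ;
     Complex.exp (M.θ * Complex.I) * Real.cos M.φ, -(Real.sin M.φ : ℂ)]

/-- The spectral projection `(1 + x M) / 2` of the observable for the outcome `x ∈ {-1, +1}`. -/
def VNMeasurement.projector (M : VNMeasurement) (x : ℤˣ) : Matrix (Fin 2) (Fin 2) ℂ :=
  (1 / 2 : ℂ) • (1 + ((x : ℤ) : ℂ) • M.observable)

/-- The state `(|0…0⟩ + |1…1⟩) / √2` of `n` qubits, as a vector indexed by the computational
basis. -/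
def ghzState (n : ℕ) : (Fin n → Fin 2) → ℂ := fun b =>
  (((Real.sqrt 2)⁻¹ : ℝ) : ℂ) *
    ((if b = fun _ => 0 then 1 else 0) + (if b = fun _ => 1 then 1 else 0))

/-- The joint projector `⊗ⱼ Pⱼ(xⱼ)`. -/
def jointProjector {n : ℕ} (M : Fin n → VNMeasurement) (x : Fin n → ℤˣ) :
    Matrix (Fin n → Fin 2) (Fin n → Fin 2) ℂ :=
  Matrix.of fun b b' => ∏ j, (M j).projector (x j) (b j) (b' j)

/-- The GHZ distribution (Born rule): the probability `⟨Ψ, (⊗ⱼ Pⱼ(xⱼ)) Ψ⟩` that the local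
measurements `M` on the GHZ state give the outcomes `x`. -/
def ghzProb {n : ℕ} (M : Fin n → VNMeasurement) (x : Fin n → ℤˣ) : ℝ :=
  (dotProduct (star (ghzState n)) ((jointProjector M x).mulVec (ghzState n))).re

/-! ## Protocols in the sequential model

There are `m + 1` parties: a leader (index `0`), and parties `Fin.succ j` for `j : Fin m`.
The leader has a private two-way channel with each other party.  Only the leader tosses coins. -/

/-- Straight-line programs of the leader: toss a fair coin, send a bit to party `j`, receive a bit
from party `j`, or finish with a value. -/
inductive LeaderProg (m : ℕ) (α : Type) : Type
  | done : α → LeaderProg m α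
  | toss : (Bool → LeaderProg m α) → LeaderProg m α
  | send : Fin m → Bool → LeaderProg m α → LeaderProg m α
  | recv : Fin m → (Bool → LeaderProg m α) → LeaderProg m α

def LeaderProg.bind {m : ℕ} {α β : Type} : LeaderProg m α → (α → LeaderProg m β) → LeaderProg m β
  | .done a, f => f a
  | .toss k, f => .toss fun b => (k b).bind f
  | .send j b k, f => .send j b (k.bind f)
  | .recv j k, f => .recv j fun b => (k b).bind f

instance (m : ℕ) : Monad (LeaderProg m) where
  pure := .done
  bind := .bind

/-- Straight-line programs of a party other than the leader: send a bit to the leader, receive a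
bit from the leader, or finish with a value.  They are deterministic. -/
inductive PartyProg (α : Type) : Type
  | done : α → PartyProg α
  | send : Bool → PartyProg α → PartyProg α
  | recv : (Bool → PartyProg α) → PartyProg α

def PartyProg.bind {α β : Type} : PartyProg α → (α → PartyProg β) → PartyProg β
  | .done a, f => f a
  | .send b k, f => .send b (k.bind f)
  | .recv k, f => .recv fun b => (k b).bind f

instance : Monad PartyProg where
  pure := .done
  bind := .bind

/-- A protocol.  Each party repeatedly runs a straight-line program that depends on its own
measurement and its own local state only, and that finishes either with a new local state, from
which the party goes on, or with the output (in `{-1, +1}`) of that party. -/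
structure Protocol (m : ℕ) where
  LState : Type
  leaderInit : LState
  leader : VNMeasurement → LState → LeaderProg m (LState ⊕ ℤˣ)
  PState : Type
  partyInit : PState
  party : Fin m → VNMeasurement → PState → PartyProg (PState ⊕ ℤˣ)

namespace Protocol

variable {m : ℕ} (π : Protocol m) (M : Fin (m + 1) → VNMeasurement)

/-- A global configuration: what remains of the current program of every party. -/
structure Config where
  leader : LeaderProg m (π.LState ⊕ ℤˣ)
  party : Fin m → PartyProg (π.PState ⊕ ℤˣ)

def initConfig : π.Config where
  leader := .done (.inl π.leaderInit)
  party := fun _ => .done (.inl π.partyInit)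

/-- Every party whose program has finished with a new local state starts its next program. -/
def refresh (c : π.Config) : π.Config where
  leader := match c.leader with
    | .done (.inl s) => π.leader (M 0) s
    | p => p
  party := fun j => match c.party j with
    | .done (.inl s) => π.party j (M j.succ) s
    | p => p

/-- One step of the joint execution: a coin toss of the leader, the transmission of one bit
between the leader and one other party, or a step without either. -/
inductive Event (C : Type) : Type
  | coin : (Bool → C) → Event C
  | bit : C → Event C
  | silent : C → Event C

/-- The step in which the leader performs the next action of its program.  A bit is transmitted
only when one side of the channel is ready to send and the other one is ready to receive. -/
def act (c : π.Config) : Event π.Config :=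
  match c.leader with
  | .done _ => .silent c
  | .toss k => .coin fun b => ⟨k b, c.party⟩
  | .send j b k =>
    match c.party j with
    | .recv q => .bit ⟨k, Function.update c.party j (q b)⟩
    | _ => .silent c
  | .recv j k =>
    match c.party j with
    | .send b q => .bit ⟨k b, Function.update c.party j q⟩
    | _ => .silent c

def nextEvent (c : π.Config) : Event π.Config := π.act (π.refresh M c)

/-- The law of the configuration after a step; coins are fair. -/
def Event.law {C : Type} : Event C → PMF C
  | .coin f => (PMF.uniformOfFintype Bool).map f
  | .bit c => PMF.pure c
  | .silent c => PMF.pure c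

def Event.coins {C : Type} : Event C → ENNReal
  | .coin _ => 1
  | _ => 0

def Event.bits {C : Type} : Event C → ENNReal
  | .bit _ => 1
  | _ => 0

/-- The law of the configuration after `t` steps; the coins of different steps are independent. -/
def run : ℕ → PMF π.Config
  | 0 => PMF.pure π.initConfig
  | t + 1 => (run t).bind fun c => (π.nextEvent M c).law

/-- All parties have halted, the party with index `j` with output `x j`. -/
def Outputs (c : π.Config) (x : Fin (m + 1) → ℤˣ) : Prop :=
  c.leader = .done (.inr (x 0)) ∧ ∀ j : Fin m, c.party j = .done (.inr (x j.succ))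

/-- The probability that the protocol eventually halts with outputs `x` (halted configurations
never change, so this is the limit of the probabilities of having halted after `t` steps). -/
def outputProb (x : Fin (m + 1) → ℤˣ) : ENNReal :=
  ⨆ t, (π.run M t).toOuterMeasure {c | π.Outputs c x}

/-- The expected total number of coin tosses: the sum over all steps of the probability that this
step is a coin toss. -/
def expectedCoins : ENNReal :=
  ∑' t, ∑' c, π.run M t c * (π.nextEvent M c).coins

/-- The expected total number of bits transmitted, in both directions and over all channels. -/
def expectedBits : ENNReal :=
  ∑' t, ∑' c, π.run M t c * (π.nextEvent M c).bits

end Protocol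

/-! ## The protocol for sampling the GHZ distribution -/

open Classical in
/-- The `i`-th binary digit (`i ≥ 1`) of `y ∈ [0, 1]`, where `1 = 0.111…`. -/
def binDigit (y : ℝ) (i : ℕ) : Bool :=
  decide (1 ≤ y ∨ ⌊y * 2 ^ i⌋ % 2 = 1)

/-- `⌈log₂ n⌉` for the number `n = m + 1` of parties. -/
def logParties (m : ℕ) : ℕ := Nat.clog 2 (m + 1)

/-- The numbers in `[0, 1]` whose binary digits a party sends: `θ / 2` is scaled by `8` (so its
first three digits are the integer part of `θ / 2`), and `v ∈ [-1, 1]` is sent as `(v + 1) / 2`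
(so the first digit is the sign of `v` and `ℓ + 1` digits give the truncation
`⌊v 2 ^ ℓ⌋ / 2 ^ ℓ`). -/
def encodeAngle (θ : ℝ) : ℝ := θ / 2 / 8
def decodeAngle (y : ℝ) : ℝ := 8 * y
def encodeSigned (v : ℝ) : ℝ := (v + 1) / 2
def decodeSigned (y : ℝ) : ℝ := 2 * y - 1

/-- `c = cos ((φ - (π/2) x) / 2)` and `s = - sin ((φ - (π/2) x) / 2)`. -/
def cosAmp (M : VNMeasurement) (x : ℤˣ) : ℝ :=
  Real.cos ((M.φ - Real.pi / 2 * ((x : ℤ) : ℝ)) / 2)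
def sinAmp (M : VNMeasurement) (x : ℤˣ) : ℝ :=
  -Real.sin ((M.φ - Real.pi / 2 * ((x : ℤ) : ℝ)) / 2)

/-- The parameter `cos² ((φ - π/2) / 2)` of the local Rademacher distribution. -/
def radParam (M : VNMeasurement) : ℝ := cosAmp M 1 ^ 2

/-- In round `k ≥ 1` of a loop that requires `first + k` binary digits of a number, those still
missing are sent: `first + 1` of them in round `1`, one in each later round.  The index of the
first missing digit, and how many are missing. -/
def batchStart (first k : ℕ) : ℕ := if k = 1 then 1 else first + k
def batchSize (first k : ℕ) : ℕ := if k = 1 then first + 1 else 1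

/-- Digits in excess of `k` for the angles: 3 for the integer part, and `ℓ = k + ⌈log₂ n⌉`. -/
def angleExtra (m : ℕ) : ℕ := 3 + logParties m

/-- Digits in excess of `k` for `c` and `s`: 1 for the sign, and `ℓ = k + 3 + ⌈log₂ n⌉`. -/
def ampExtra (m : ℕ) : ℕ := 4 + logParties m

def bitVal (b : Bool) : ℝ := if b then 1 else 0

/-! ### Parties other than the leader -/

/-- Send `cnt` binary digits of `y`, from the one with index `i` on. -/
def sendDigits (y : ℝ) : (cnt : ℕ) → (i : ℕ) → PartyProg Unit
  | 0, _ => .done ()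
  | cnt + 1, i => .send (binDigit y i) (sendDigits y cnt (i + 1))

inductive GHZPartyState : Type
  /-- round `k` of the Bernoulli sampler -/
  | bern (k : ℕ)
  /-- start of a round of the rejection algorithm -/
  | trial
  /-- sampling `X_j`: the `i`-th random digit is awaited -/
  | rademacher (S : Bool) (i : ℕ)
  /-- round `k` of the acceptance test for the tentative output `X` -/
  | test (X : ℤˣ) (k : ℕ)

open GHZPartyState in
def ghzParty (m : ℕ) (M : VNMeasurement) : GHZPartyState → PartyProg (GHZPartyState ⊕ ℤˣ)
  | bern k => do
      sendDigits (encodeAngle M.θ) (batchSize (angleExtra m) k) (batchStart (angleExtra m) k)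
      let more ← .recv .done
      return .inl (if more then bern (k + 1) else trial)
  | trial => do
      let S ← .recv .done
      return .inl (rademacher S 1)
  | rademacher S i => do
      -- the random number `0.V₁V₂…` is compared with the parameter digit by digit;
      -- the reply tells the leader whether a further random digit is needed
      let V ← .recv .done
      let more : Bool := V == binDigit (radParam M) i
      .send more (.done ())
      if more then return .inl (rademacher S (i + 1))
      else
        let X : ℤˣ := if V then -1 else 1
        return .inl (test (if S then -X else X) 1)
  | test X k => do
      sendDigits (encodeSigned (cosAmp M X)) (batchSize (ampExtra m) k) (batchStart (ampExtra m) k)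
      sendDigits (encodeSigned (sinAmp M X)) (batchSize (ampExtra m) k) (batchStart (ampExtra m) k)
      let more ← .recv .done
      if more then return .inl (test X (k + 1))
      else
        let accepted ← .recv .done
        return (if accepted then .inr X else .inl trial)

/-! ### The leader -/

/-- Receive `cnt` binary digits from party `j`, the first of which has index `i`, and add them to
the truncation `y` known so far. -/
def recvDigits {m : ℕ} (j : Fin m) : (cnt : ℕ) → (i : ℕ) → (y : ℝ) → LeaderProg m ℝ
  | 0, _, y => .done y
  | cnt + 1, i, y => .recv j fun b => recvDigits j cnt (i + 1) (y + bitVal b / 2 ^ i)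

/-- Send the bit `b` to all the listed parties. -/
def sendAll {m : ℕ} (b : Bool) : List (Fin m) → LeaderProg m Unit
  | [] => .done ()
  | j :: js => .send j b (sendAll b js)

/-- Run `f j`, which returns the new value at `j`, for all the listed parties `j`. -/
def forAll {m : ℕ} {α : Type} (f : Fin m → LeaderProg m α) :
    List (Fin m) → (Fin m → α) → LeaderProg m (Fin m → α)
  | [], v => .done v
  | j :: js, v => do
      let a ← f j
      forAll f js (Function.update v j a)

inductive GHZLeaderState (m : ℕ) : Type
  /-- round `k` of the Bernoulli sampler, with `U = U(k-1)` and the truncations `y` of the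
  encoded angles that have been received so far -/
  | bern (k : ℕ) (U : ℝ) (y : Fin m → ℝ)
  /-- start of a round of the rejection algorithm -/
  | trial (B : Bool)
  /-- sampling `X₁`, with the `i`-th random digit -/
  | rademacher (B S : Bool) (i : ℕ)
  /-- the parties in the list are still to be served with random digits -/
  | deal (B : Bool) (X : ℤˣ) (js : List (Fin m))
  /-- round `k` of the acceptance test, with `U = U(k-1)` and the truncations of the encoded
  numbers `c_j` and `s_j` that have been received so far -/
  | test (B : Bool) (X : ℤˣ) (k : ℕ) (U : ℝ) (y : Fin m → ℝ × ℝ)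

open GHZLeaderState Classical in
def ghzLeader (m : ℕ) (M : VNMeasurement) :
    GHZLeaderState m → LeaderProg m (GHZLeaderState m ⊕ ℤˣ)
  | bern k U y => do
      let b ← .toss .done
      let U' := U + bitVal b / 2 ^ k
      let y' ← forAll (fun j => recvDigits j (batchSize (angleExtra m) k)
        (batchStart (angleExtra m) k) (y j)) (List.finRange m) y
      -- a `k`-bit approximation of `cos² (θ / 2)`, for the sum `θ` of all azimuthal angles
      let p := Real.cos (M.θ / 2 + ∑ j, decodeAngle (y' j)) ^ 2
      if U' ≤ p - 2 / 2 ^ k then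
        sendAll false (List.finRange m)
        return .inl (trial true)
      else if U' ≥ p + 1 / 2 ^ k then
        sendAll false (List.finRange m)
        return .inl (trial false)
      else
        sendAll true (List.finRange m)
        return .inl (bern (k + 1) U' y')
  | trial B => do
      let S ← .toss .done
      sendAll S (List.finRange m)
      return .inl (rademacher B S 1)
  | rademacher B S i => do
      let V ← .toss .done
      if V = binDigit (radParam M) i then return .inl (rademacher B S (i + 1))
      else
        let X : ℤˣ := if V then -1 else 1
        return .inl (deal B (if S then -X else X) (List.finRange m))
  | deal B X [] => return .inl (test B X 1 0 fun _ => (0, 0))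
  | deal B X (j :: js) => do
      let V ← .toss .done
      .send j V (.done ())
      let more ← .recv j .done
      return .inl (deal B X (if more then j :: js else js))
  | test B X k U y => do
      let b ← .toss .done
      let U' := U + bitVal b / 2 ^ k
      let y' ← forAll (fun j => do
        let c ← recvDigits j (batchSize (ampExtra m) k) (batchStart (ampExtra m) k) (y j).1
        let s ← recvDigits j (batchSize (ampExtra m) k) (batchStart (ampExtra m) k) (y j).2
        return (c, s)) (List.finRange m) y
      -- approximations of `a₁(X)` and `a₂(X)`; the sign of the latter is changed in order to
      -- sample `p₂` instead of `p₁`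
      let a₁ := cosAmp M X * ∏ j, decodeSigned (y' j).1
      let a₂ := (if B then sinAmp M X else -sinAmp M X) * ∏ j, decodeSigned (y' j).2
      let L := a₁ ^ 2 + a₂ ^ 2
      let R := (a₁ + a₂) ^ 2 / 2
      if U' * L - R < -(4 / 2 ^ k) then
        sendAll false (List.finRange m)
        sendAll true (List.finRange m)
        return .inr X
      else if U' * L - R > 4 / 2 ^ k then
        sendAll false (List.finRange m)
        sendAll false (List.finRange m)
        return .inl (trial B)
      else
        sendAll true (List.finRange m)
        return .inl (test B X (k + 1) U' y')

/-- The complete protocol for `m + 1` parties: first a Bernoulli bit `B` with parameter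
`cos² (θ / 2)` is sampled, then the rejection algorithm is run for `p₁` if `B = 1` and for `p₂`
if `B = 0`. -/
def ghzProtocol (m : ℕ) : Protocol m where
  LState := GHZLeaderState m
  leaderInit := .bern 1 0 fun _ => 0
  leader := ghzLeader m
  PState := GHZPartyState
  partyInit := .bern 1
  party := fun _ => ghzParty m

end

noncomputable section

open scoped ENNReal

/-! ### Expected values along an execution -/

section PMFSums

variable {α β : Type}

/-! Only |0…0⟩ and |1…1⟩ enter the Born rule. With a₁ = ∏ c_j and a₂ = ∏ s_j this gives p = (a₁² +
a₂²)/2 + a₁a₂ cos θ, which is the mixture of (a₁ + a₂)²/2 and (a₁ - a₂)²/2 with weights cos²(θ/2)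
and sin²(θ/2) (`ghzProb_eq_mix`). The bit `B` chooses the component. The tentative sample has law
L/2, where L = a₁² + a₂² dominates both components, so rejection sampling accepts with probability
1/2. Truncation does not spoil exactness: the margins of the tests exceed the truncation errors, so
no comparison is ever decided wrongly.

The execution is treated as a Markov chain with prices on coins, bits and idle steps and with a
reward on outputs. `value` is the expected price plus reward within `t` steps. Each stage of the
protocol has a closed-form potential that satisfies a one-step inequality, so induction on `t`
(`stageBounds`) bounds `value` by the potential, with no prior knowledge of termination. Four
choices of prices suffice. Pricing coins only, or bits only, bounds the two costs. Pricing every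
step gives a finite expected duration, hence halting with probability 1. Rewarding a single output
`x` gives P(x) ≤ p(x). Since p has mass 1 and the output probabilities sum to at least 1, equality
holds (`outputProb_eq`).

For the costs, a test is undecided after k rounds only if U(k) is one of at most 9/L + 1 grid
points. Weighting by L/2 and summing over the 2ⁿ outcomes bounds the survival probability by (9/2 ·
2ⁿ + 1) 2⁻ᵏ, so a test takes about n rounds on average (`sum_envelope_mul_loopRounds_testGo_le`).
Each round costs O(n) bits. -/

lemma PMF.tsum_pure_mul (a : α) (h : α → ℝ≥0∞) : ∑' c, PMF.pure a c * h c = h a := by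
  rw [tsum_eq_single a]
  · simp
  · intro b hb; simp [PMF.pure_apply, hb]

lemma PMF.tsum_bind_mul (p : PMF α) (k : α → PMF β) (h : β → ℝ≥0∞) :
    ∑' c, p.bind k c * h c = ∑' a, p a * ∑' c, k a c * h c := by
  simp_rw [PMF.bind_apply, ← ENNReal.tsum_mul_right]
  rw [ENNReal.tsum_comm]
  simp_rw [mul_assoc, ENNReal.tsum_mul_left]

end PMFSums

namespace Protocol

variable {m : ℕ} {π : Protocol m} {M : Fin (m + 1) → VNMeasurement}

/-- The expectation of `h` after one step. -/
def Event.mean {C : Type} (h : C → ℝ≥0∞) : Event C → ℝ≥0∞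
  | .coin f => (h (f true) + h (f false)) / 2
  | .bit c => h c
  | .silent c => h c

lemma Event.tsum_law_mul {C : Type} (e : Event C) (h : C → ℝ≥0∞) :
    ∑' c, e.law c * h c = e.mean h := by
  cases e with
  | coin f =>
    simp only [Event.law, Event.mean, PMF.map, PMF.tsum_bind_mul, Function.comp,
      PMF.tsum_pure_mul]
    rw [tsum_fintype]
    simp [← mul_add, ENNReal.div_eq_inv_mul]
  | bit c => exact PMF.tsum_pure_mul _ _
  | silent c => exact PMF.tsum_pure_mul _ _

lemma Event.mean_mono {C : Type} (e : Event C) {h h' : C → ℝ≥0∞} (hh : ∀ c, h c ≤ h' c) :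
    e.mean h ≤ e.mean h' := by
  cases e with
  | coin f => exact ENNReal.div_le_div_right (add_le_add (hh _) (hh _)) _
  | bit c => exact hh _
  | silent c => exact hh _

/-- The expectation of `h` after `t` steps. -/
def expect (π : Protocol m) (M : Fin (m + 1) → VNMeasurement) (t : ℕ) (h : π.Config → ℝ≥0∞) :
    ℝ≥0∞ :=
  ∑' c, π.run M t c * h c

lemma expect_zero (h : π.Config → ℝ≥0∞) : π.expect M 0 h = h π.initConfig :=
  PMF.tsum_pure_mul _ _

lemma expect_succ (t : ℕ) (h : π.Config → ℝ≥0∞) :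
    π.expect M (t + 1) h = π.expect M t fun c => (π.nextEvent M c).mean h := by
  simp only [expect, run, PMF.tsum_bind_mul, Event.tsum_law_mul]

lemma expect_add (t : ℕ) (h h' : π.Config → ℝ≥0∞) :
    π.expect M t (fun c => h c + h' c) = π.expect M t h + π.expect M t h' := by
  simp only [expect, mul_add, ENNReal.tsum_add]

lemma expect_mono (t : ℕ) {h h' : π.Config → ℝ≥0∞} (hh : ∀ c, h c ≤ h' c) :
    π.expect M t h ≤ π.expect M t h' :=
  ENNReal.tsum_le_tsum fun c => mul_le_mul_right (hh c) _

lemma expect_one (t : ℕ) : π.expect M t (fun _ => 1) = 1 := by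
  simp only [expect, mul_one, PMF.tsum_coe]

lemma toOuterMeasure_run (t : ℕ) (s : Set π.Config) :
    (π.run M t).toOuterMeasure s = π.expect M t (s.indicator 1) := by
  rw [PMF.toOuterMeasure_apply, expect]
  refine tsum_congr fun c => ?_
  by_cases h : c ∈ s <;> simp [h]

/-! ### Prices, rewards and their expected value -/

/-- Prices for a coin toss, the transmission of a bit, a step of neither kind before the end, and
a reward for the outputs. -/
structure Pricing (m : ℕ) where
  coin : ℝ≥0∞
  bit : ℝ≥0∞
  idle : ℝ≥0∞
  reward : (Fin (m + 1) → ℤˣ) → ℝ≥0∞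

open Classical in
-- A silent step is free only once all parties have halted. A deadlock would be charged `idle` for
-- ever, so a finite bound with `idle = 1` excludes it.
def price (w : Pricing m) : Event π.Config → ℝ≥0∞
  | .coin _ => w.coin
  | .bit _ => w.bit
  | .silent c => if ∃ x, π.Outputs c x then 0 else w.idle

open Classical in
def payoff (w : Pricing m) (c : π.Config) : ℝ≥0∞ :=
  ∑ x, if π.Outputs c x then w.reward x else 0

/-- The expected price of `t` steps from a configuration on, plus the expected reward after
them. -/
def value (w : Pricing m) (M : Fin (m + 1) → VNMeasurement) : ℕ → π.Config → ℝ≥0∞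
  | 0, c => payoff w c
  | t + 1, c => price w (π.nextEvent M c) + (π.nextEvent M c).mean (value w M t)

/-- Passes from sums along the law of the execution to the backward recursion of `value`. -/
lemma sum_expect_price (w : Pricing m) (s : ℕ) :
    ∑ i ∈ Finset.range s, π.expect M i (fun c => price w (π.nextEvent M c)) +
      π.expect M s (payoff w) = value w M s π.initConfig := by
  -- Steps already taken and steps still to go are separated; the induction trades one for the
  -- other.
  have key : ∀ s t, ∑ i ∈ Finset.range s, π.expect M i (fun c => price w (π.nextEvent M c)) +
      π.expect M s (value w M t) = value w M (s + t) π.initConfig := by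
    intro s
    induction s with
    | zero => intro t; simp [expect_zero]
    | succ s ih =>
      intro t
      rw [Finset.sum_range_succ, expect_succ, add_assoc, ← expect_add, Nat.succ_add_eq_add_succ,
        ← ih (t + 1)]
      rfl
  exact key s 0

lemma Outputs.unique {c : π.Config} {x y : Fin (m + 1) → ℤˣ} (hx : π.Outputs c x)
    (hy : π.Outputs c y) : x = y := by
  funext j
  refine Fin.cases ?_ (fun j => ?_) j
  · simpa using hx.1.symm.trans hy.1
  · simpa using (hx.2 j).symm.trans (hy.2 j)

lemma payoff_of_outputs (w : Pricing m) {c : π.Config} {x : Fin (m + 1) → ℤˣ}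
    (hx : π.Outputs c x) : payoff w c = w.reward x := by
  classical
  rw [payoff, Finset.sum_eq_single x]
  · simp [hx]
  · intro y _ hy
    rw [if_neg]
    exact fun h => hy (h.unique hx)
  · simp

lemma payoff_of_not_outputs (w : Pricing m) {c : π.Config} (hx : ∀ x, ¬ π.Outputs c x) :
    payoff w c = 0 := by
  simp [payoff, hx]

lemma Outputs.refresh {c : π.Config} {x : Fin (m + 1) → ℤˣ} (hx : π.Outputs c x) :
    π.refresh M c = c := by
  obtain ⟨l, p⟩ := c
  obtain ⟨h0, h1⟩ := hx
  simp only at h0 h1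
  simp only [Protocol.refresh, h0, Config.mk.injEq, true_and]
  funext j
  simp only [h1]

lemma Outputs.nextEvent {c : π.Config} {x : Fin (m + 1) → ℤˣ} (hx : π.Outputs c x) :
    π.nextEvent M c = .silent c := by
  rw [Protocol.nextEvent, hx.refresh, act, hx.1]

/-- Prices are nonnegative and halted configurations are absorbing. Hence steps may be given away in
upper bounds. -/
lemma value_le_succ (w : Pricing m) (t : ℕ) (c : π.Config) :
    value w M t c ≤ value w M (t + 1) c := by
  induction t generalizing c with
  | zero =>
    by_cases h : ∃ x, π.Outputs c x
    · obtain ⟨x, hx⟩ := h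
      rw [value, value, hx.nextEvent]
      exact le_add_self
    · rw [value, payoff_of_not_outputs w (not_exists.mp h)]
      exact zero_le
  | succ t ih => exact add_le_add le_rfl (Event.mean_mono _ ih)

lemma value_of_outputs (w : Pricing m) (t : ℕ) {c : π.Config} {x : Fin (m + 1) → ℤˣ}
    (hx : π.Outputs c x) : value w M t c = w.reward x := by
  induction t with
  | zero => exact payoff_of_outputs w hx
  | succ t ih =>
    rw [value, hx.nextEvent, price, if_pos ⟨x, hx⟩, zero_add]
    exact ih

lemma value_eq_of_refresh (w : Pricing m) (t : ℕ) {c c' : π.Config}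
    (h : π.refresh M c = π.refresh M c') : value w M (t + 1) c = value w M (t + 1) c' := by
  simp only [value, nextEvent, h]

/-! ### Execution of single actions -/

/-- No program halts or changes the local state without an action, except that the leader may
pass to a new state. -/
structure Delayed (π : Protocol m) : Prop where
  leader : ∀ M s a, π.leader M s ≠ .done (.inr a)
  party : ∀ j M s a, π.party j M s ≠ .done a

/-- The program of a party after it has been restarted, if necessary. -/
def resume (π : Protocol m) (M : Fin (m + 1) → VNMeasurement) (j : Fin m) :
    PartyProg (π.PState ⊕ ℤˣ) → PartyProg (π.PState ⊕ ℤˣ)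
  | .done (.inl s) => π.party j (M j.succ) s
  | p => p

lemma Delayed.outputs_of_refresh (hπ : π.Delayed) {c : π.Config} {x : Fin (m + 1) → ℤˣ}
    (hx : π.Outputs (π.refresh M c) x) : π.Outputs c x := by
  obtain ⟨l, p⟩ := c
  obtain ⟨h0, h1⟩ := hx
  constructor
  · match l, h0 with
    | .done (.inl s), h0 => exact absurd h0 (hπ.leader _ _ _)
    | .done (.inr s), h0 => exact h0
  · intro j
    have := h1 j
    simp only [Protocol.refresh] at this
    generalize hp : p j = q at this
    match q, this with
    | .done (.inl s), h0 => exact absurd h0 (hπ.party _ _ _ _)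
    | .done (.inr s), h0 => exact hp.trans h0

lemma Delayed.resume_resume (hπ : π.Delayed) (j : Fin m) (p : PartyProg (π.PState ⊕ ℤˣ)) :
    π.resume M j (π.resume M j p) = π.resume M j p := by
  match p with
  | .done (.inl s) =>
    simp only [resume]
    generalize hq : π.party j (M j.succ) s = q
    match q, hq with
    | .done a, hq => exact absurd hq (hπ.party _ _ _ _)
    | .send .., _ => rfl
    | .recv .., _ => rfl
  | .done (.inr s) => rfl
  | .send .. => rfl
  | .recv .. => rfl

/-- Whether a party has already been restarted is mere bookkeeping: `refresh` restarts it before the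
next step anyway. -/
lemma Delayed.value_congr (hπ : π.Delayed) (w : Pricing m) (t : ℕ)
    (l : LeaderProg m (π.LState ⊕ ℤˣ)) {p p' : Fin m → PartyProg (π.PState ⊕ ℤˣ)}
    (h : ∀ j, π.resume M j (p j) = π.resume M j (p' j)) :
    value w M t (⟨l, p⟩ : π.Config) = value w M t ⟨l, p'⟩ := by
  have hr : π.refresh M (⟨l, p⟩ : π.Config) = π.refresh M ⟨l, p'⟩ := by
    show Config.mk _ (fun j => π.resume M j (p j)) = Config.mk _ (fun j => π.resume M j (p' j))
    simp only [h]
  cases t with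
  | zero =>
    -- With no step left nothing is refreshed. The payoffs still agree because restarting never
    -- creates or destroys an output.
    have ho : ∀ x, π.Outputs (⟨l, p⟩ : π.Config) x ↔ π.Outputs (⟨l, p'⟩ : π.Config) x := by
      intro x
      constructor
      · intro hx
        exact hπ.outputs_of_refresh (M := M) (hr ▸ (hx.refresh (M := M)).symm ▸ hx)
      · intro hx
        exact hπ.outputs_of_refresh (M := M) (hr.symm ▸ (hx.refresh (M := M)).symm ▸ hx)
    refine Finset.sum_congr rfl fun x _ => ?_
    by_cases hx : π.Outputs (⟨l, p'⟩ : π.Config) x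
    · rw [if_pos hx, if_pos ((ho x).2 hx)]
    · rw [if_neg hx, if_neg (mt (ho x).1 hx)]
  | succ t => exact value_eq_of_refresh w t hr

/-- Tosses, together with the idle step of the leader, are the actions that use up the step budget
and thus drive the induction on `t`. -/
lemma Delayed.value_toss (hπ : π.Delayed) (w : Pricing m) (t : ℕ)
    (k : Bool → LeaderProg m (π.LState ⊕ ℤˣ)) (p : Fin m → PartyProg (π.PState ⊕ ℤˣ)) :
    value w M (t + 1) (⟨.toss k, p⟩ : π.Config) =
      w.coin + (value w M t ⟨k true, p⟩ + value w M t ⟨k false, p⟩) / 2 := by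
  have h : ∀ b, value w M t (⟨k b, p⟩ : π.Config) =
      value w M t ⟨k b, fun j => π.resume M j (p j)⟩ := fun b =>
    hπ.value_congr w t _ fun j => (hπ.resume_resume j _).symm
  rw [h, h]
  rfl

/-- The step spent on the transmission is given away by `value_le_succ`, so `t` stays the same and
only the price of a bit appears. Whole blocks of communication can then be chained without counting
steps. -/
lemma Delayed.value_send_le (hπ : π.Delayed) (w : Pricing m) (t : ℕ) (j : Fin m) (b : Bool)
    (k : LeaderProg m (π.LState ⊕ ℤˣ)) {p : Fin m → PartyProg (π.PState ⊕ ℤˣ)}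
    {q : Bool → PartyProg (π.PState ⊕ ℤˣ)} (hp : p j = .recv q) :
    value w M t (⟨.send j b k, p⟩ : π.Config) ≤
      w.bit + value w M t ⟨k, Function.update p j (q b)⟩ := by
  refine (value_le_succ w t _).trans (le_of_eq ?_)
  have h : value w M t (⟨k, Function.update p j (q b)⟩ : π.Config) =
      value w M t ⟨k, Function.update (fun j => π.resume M j (p j)) j (q b)⟩ := by
    refine hπ.value_congr w t _ fun i => ?_
    rcases eq_or_ne i j with rfl | hij
    · simp
    · simp [hij, hπ.resume_resume]
  have he : π.nextEvent M (⟨.send j b k, p⟩ : π.Config) =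
      .bit ⟨k, Function.update (fun j => π.resume M j (p j)) j (q b)⟩ := by
    have : π.refresh M (⟨.send j b k, p⟩ : π.Config) =
      ⟨.send j b k, fun j => π.resume M j (p j)⟩ := rfl
    simp only [nextEvent, this, act, hp, resume]
  rw [value, he, h]
  rfl

lemma Delayed.value_recv_le (hπ : π.Delayed) (w : Pricing m) (t : ℕ) (j : Fin m) (b : Bool)
    (k : Bool → LeaderProg m (π.LState ⊕ ℤˣ)) {p : Fin m → PartyProg (π.PState ⊕ ℤˣ)}
    {q : PartyProg (π.PState ⊕ ℤˣ)} (hp : p j = .send b q) :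
    value w M t (⟨.recv j k, p⟩ : π.Config) ≤
      w.bit + value w M t ⟨k b, Function.update p j q⟩ := by
  refine (value_le_succ w t _).trans (le_of_eq ?_)
  have h : value w M t (⟨k b, Function.update p j q⟩ : π.Config) =
      value w M t ⟨k b, Function.update (fun j => π.resume M j (p j)) j q⟩ := by
    refine hπ.value_congr w t _ fun i => ?_
    rcases eq_or_ne i j with rfl | hij
    · simp
    · simp [hij, hπ.resume_resume]
  have he : π.nextEvent M (⟨.recv j k, p⟩ : π.Config) =
      .bit ⟨k b, Function.update (fun j => π.resume M j (p j)) j q⟩ := by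
    have : π.refresh M (⟨.recv j k, p⟩ : π.Config) =
      ⟨.recv j k, fun j => π.resume M j (p j)⟩ := rfl
    simp only [nextEvent, this, act, hp, resume]
  rw [value, he, h]
  rfl

lemma Delayed.value_send_recv_le (hπ : π.Delayed) (w : Pricing m) (t : ℕ) (j : Fin m) (b : Bool)
    (k : Bool → LeaderProg m (π.LState ⊕ ℤˣ)) {p : Fin m → PartyProg (π.PState ⊕ ℤˣ)}
    (e : Bool → Bool) (q : Bool → PartyProg (π.PState ⊕ ℤˣ))
    (hp : p j = .recv fun b => .send (e b) (q b)) :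
    value w M t (⟨.send j b (.recv j k), p⟩ : π.Config) ≤
      2 * w.bit + value w M t ⟨k (e b), Function.update p j (q b)⟩ := by
  refine (hπ.value_send_le w t j b _ hp).trans ?_
  refine (add_le_add le_rfl
    (hπ.value_recv_le w t j _ _ (Function.update_self ..))).trans (le_of_eq ?_)
  rw [Function.update_idem, two_mul, add_assoc]

lemma Delayed.value_update_state (hπ : π.Delayed) (w : Pricing m) (t : ℕ)
    (k : LeaderProg m (π.LState ⊕ ℤˣ)) (σ σ' : Fin m → π.PState) (j : Fin m) (s : π.PState)
    (hs : σ' j = s) (hσ : ∀ i, i ≠ j → σ' i = σ i) :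
    value w M t (⟨k, Function.update (fun i => π.party i (M i.succ) (σ i)) j (.done (.inl s))⟩ :
      π.Config) = value w M t ⟨k, fun i => .done (.inl (σ' i))⟩ := by
  refine hπ.value_congr w t k fun i => ?_
  rcases eq_or_ne i j with rfl | hi
  · rw [Function.update_self, hs]
  · rw [Function.update_of_ne hi, hσ i hi]
    exact hπ.resume_resume i (.done (.inl (σ i)))

/-- The leader and all parties at the start of their next programs. -/
def atStates (π : Protocol m) (s : π.LState) (σ : Fin m → π.PState) : π.Config :=
  ⟨.done (.inl s), fun j => .done (.inl (σ j))⟩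

lemma payoff_done_inl (w : Pricing m) (s : π.LState)
    (p : Fin m → PartyProg (π.PState ⊕ ℤˣ)) : payoff w (⟨.done (.inl s), p⟩ : π.Config) = 0 :=
  payoff_of_not_outputs w fun x hx => by simpa using hx.1

lemma value_zero_atStates (w : Pricing m) (s : π.LState) (σ : Fin m → π.PState) :
    value w M 0 (π.atStates s σ) = 0 := payoff_done_inl _ _ _

/-- A step that starts with a coin toss of the leader. -/
lemma Delayed.value_atStates_toss (hπ : π.Delayed) (w : Pricing m) (t : ℕ) (s : π.LState)
    (σ : Fin m → π.PState) {k : Bool → LeaderProg m (π.LState ⊕ ℤˣ)}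
    (hs : π.leader (M 0) s = .toss k) :
    value w M (t + 1) (π.atStates s σ) =
      w.coin + (value w M t ⟨k true, fun j => π.party j (M j.succ) (σ j)⟩ +
        value w M t ⟨k false, fun j => π.party j (M j.succ) (σ j)⟩) / 2 := by
  rw [← hπ.value_toss w t k, ← hs]
  refine value_eq_of_refresh w t ?_
  have hr : ∀ j, π.resume M j (π.party j (M j.succ) (σ j)) = π.party j (M j.succ) (σ j) :=
    fun j => hπ.resume_resume j (.done (.inl (σ j)))
  show Config.mk (π.leader (M 0) s) (fun j => π.party j (M j.succ) (σ j)) =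
    π.refresh M ⟨π.leader (M 0) s, _⟩
  rw [hs]
  show _ = Config.mk _ (fun j => π.resume M j (π.party j (M j.succ) (σ j)))
  simp only [hr]

/-- A step in which the leader only changes its state. -/
lemma Delayed.value_atStates_idle (hπ : π.Delayed) (w : Pricing m) (t : ℕ) (s s' : π.LState)
    (σ : Fin m → π.PState) (hs : π.leader (M 0) s = .done (.inl s')) :
    value w M (t + 1) (π.atStates s σ) ≤ w.idle + value w M t (π.atStates s' σ) := by
  have h : value w M t (π.atStates s' σ) =
      value w M t ⟨.done (.inl s'), fun j => π.party j (M j.succ) (σ j)⟩ :=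
    hπ.value_congr w t _ fun j => (hπ.resume_resume j (.done (.inl (σ j)))).symm
  have he : π.nextEvent M (π.atStates s σ) =
      .silent ⟨.done (.inl s'), fun j => π.party j (M j.succ) (σ j)⟩ := by
    have : π.refresh M (π.atStates s σ) =
      ⟨π.leader (M 0) s, fun j => π.party j (M j.succ) (σ j)⟩ := rfl
    simp only [nextEvent, this, hs, act]
  rw [h, value, he]
  refine add_le_add ?_ le_rfl
  rw [price]
  split_ifs <;> simp

end Protocol

/-! ### Programs that are built from others -/

lemma LeaderProg.bind_assoc {m : ℕ} {α β γ : Type} (p : LeaderProg m α)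
    (f : α → LeaderProg m β) (g : β → LeaderProg m γ) :
    (p.bind f).bind g = p.bind fun a => (f a).bind g := by
  induction p with
  | done a => rfl
  | toss k ih => simp only [LeaderProg.bind, ih]
  | send j b k ih => simp only [LeaderProg.bind, ih]
  | recv j k ih => simp only [LeaderProg.bind, ih]

/-- The sum of `cnt` binary digits of `y`, from the one with index `i` on, with their weights. -/
def digitSum (y : ℝ) (cnt i : ℕ) : ℝ :=
  ∑ l ∈ Finset.range cnt, bitVal (binDigit y (i + l)) / 2 ^ (i + l)

lemma digitSum_succ (y : ℝ) (cnt i : ℕ) :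
    digitSum y (cnt + 1) i = bitVal (binDigit y i) / 2 ^ i + digitSum y cnt (i + 1) := by
  rw [digitSum, Finset.sum_range_succ', add_comm]
  simp only [digitSum, add_zero, add_assoc, add_comm 1]

namespace Protocol

variable {m : ℕ} {π : Protocol m} {M : Fin (m + 1) → VNMeasurement}

lemma Delayed.value_recvDigits_le (hπ : π.Delayed) (w : Pricing m) (t : ℕ) (j : Fin m) (y : ℝ)
    (cnt i : ℕ) (a : ℝ) (k : ℝ → LeaderProg m (π.LState ⊕ ℤˣ))
    (q : Unit → PartyProg (π.PState ⊕ ℤˣ)) {p : Fin m → PartyProg (π.PState ⊕ ℤˣ)}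
    (hp : p j = (sendDigits y cnt i).bind q) :
    value w M t (⟨(recvDigits j cnt i a).bind k, p⟩ : π.Config) ≤
      cnt * w.bit + value w M t ⟨k (a + digitSum y cnt i), Function.update p j (q ())⟩ := by
  induction cnt generalizing i a p with
  | zero =>
    simp only [sendDigits, PartyProg.bind] at hp
    simp [recvDigits, LeaderProg.bind, ← hp, digitSum]
  | succ cnt ih =>
    simp only [sendDigits, PartyProg.bind] at hp
    simp only [recvDigits, LeaderProg.bind]
    refine (hπ.value_recv_le w t j _ _ hp).trans ?_
    refine (add_le_add le_rfl (ih _ _ (Function.update_self ..))).trans ?_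
    rw [digitSum_succ, Function.update_idem, ← add_assoc, ← add_assoc]
    push_cast
    rw [add_comm w.bit, add_mul, one_mul]

lemma Delayed.value_recvDigits_two_le (hπ : π.Delayed) (w : Pricing m) (t : ℕ) (j : Fin m)
    (y y' : ℝ) (cnt i : ℕ) (a a' : ℝ) (k : ℝ → ℝ → LeaderProg m (π.LState ⊕ ℤˣ))
    (q : Unit → PartyProg (π.PState ⊕ ℤˣ)) {p : Fin m → PartyProg (π.PState ⊕ ℤˣ)}
    (hp : p j = (sendDigits y cnt i).bind fun _ => (sendDigits y' cnt i).bind q) :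
    value w M t (⟨(recvDigits j cnt i a).bind fun c => (recvDigits j cnt i a').bind (k c), p⟩ :
        π.Config) ≤
      cnt * w.bit + cnt * w.bit +
        value w M t ⟨k (a + digitSum y cnt i) (a' + digitSum y' cnt i),
          Function.update p j (q ())⟩ := by
  refine (hπ.value_recvDigits_le w t j y cnt i a _ _ hp).trans ?_
  refine (add_le_add le_rfl (hπ.value_recvDigits_le w t j y' cnt i a' _ q
    (Function.update_self ..))).trans (le_of_eq ?_)
  rw [Function.update_idem, add_assoc]

lemma Delayed.value_sendAll_le (hπ : π.Delayed) (w : Pricing m) (t : ℕ) (b : Bool)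
    (js : List (Fin m)) (hjs : js.Nodup) (k : Unit → LeaderProg m (π.LState ⊕ ℤˣ))
    (q : Fin m → Bool → PartyProg (π.PState ⊕ ℤˣ)) {p : Fin m → PartyProg (π.PState ⊕ ℤˣ)}
    (hp : ∀ j ∈ js, p j = .recv (q j)) :
    value w M t (⟨(sendAll b js).bind k, p⟩ : π.Config) ≤
      js.length * w.bit + value w M t ⟨k (), fun j => if j ∈ js then q j b else p j⟩ := by
  induction js generalizing p with
  | nil => simp [sendAll, LeaderProg.bind]
  | cons j js ih =>
    simp only [sendAll, LeaderProg.bind]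
    rw [List.nodup_cons] at hjs
    refine (hπ.value_send_le w t j _ _ (hp j (by simp))).trans ?_
    refine (add_le_add le_rfl (ih hjs.2 fun i hi => ?_)).trans (le_of_eq ?_)
    · rw [Function.update_of_ne (by rintro rfl; exact hjs.1 hi)]
      exact hp i (by simp [hi])
    · rw [← add_assoc, List.length_cons]
      push_cast
      rw [add_comm w.bit, add_mul, one_mul]
      congr 3
      funext i
      by_cases hi : i ∈ js
      · simp [hi]
      · rcases eq_or_ne i j with rfl | hij <;> simp [*]

/-- The hypothesis is stated for arbitrary continuations, so the bounds for single parties compose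
along the list; without duplicates, serving one party leaves the programs of the others untouched.
-/
lemma value_forAll_le (w : Pricing m) (t : ℕ) {α : Type} (f : Fin m → LeaderProg m α)
    (a : Fin m → α) (c : ℝ≥0∞) (p₀ p₁ : Fin m → PartyProg (π.PState ⊕ ℤˣ))
    (hf : ∀ j (k : α → LeaderProg m (π.LState ⊕ ℤˣ)) p, p j = p₀ j →
      value w M t (⟨(f j).bind k, p⟩ : π.Config) ≤
        c + value w M t ⟨k (a j), Function.update p j (p₁ j)⟩)
    (js : List (Fin m)) (hjs : js.Nodup) (v : Fin m → α)
    (k : (Fin m → α) → LeaderProg m (π.LState ⊕ ℤˣ)) {p : Fin m → PartyProg (π.PState ⊕ ℤˣ)}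
    (hp : ∀ j ∈ js, p j = p₀ j) :
    value w M t (⟨(forAll f js v).bind k, p⟩ : π.Config) ≤
      js.length * c + value w M t
        ⟨k fun j => if j ∈ js then a j else v j, fun j => if j ∈ js then p₁ j else p j⟩ := by
  induction js generalizing p v with
  | nil => simp [forAll, LeaderProg.bind]
  | cons j js ih =>
    rw [List.nodup_cons] at hjs
    have h1 : (forAll f (j :: js) v).bind k =
        (f j).bind fun a => (forAll f js (Function.update v j a)).bind k :=
      LeaderProg.bind_assoc ..
    rw [h1]
    refine (hf j _ p (hp j (by simp))).trans ?_
    refine (add_le_add le_rfl (ih hjs.2 _ fun i hi => ?_)).trans (le_of_eq ?_)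
    · rw [Function.update_of_ne (by rintro rfl; exact hjs.1 hi)]
      exact hp i (by simp [hi])
    · rw [← add_assoc, List.length_cons]
      push_cast
      rw [add_comm c, add_mul, one_mul]
      congr 3
      · congr 1
        funext i
        by_cases hi : i ∈ js
        · simp [hi]
        · rcases eq_or_ne i j with rfl | hij <;> simp [*]
      · funext i
        by_cases hi : i ∈ js
        · simp [hi]
        · rcases eq_or_ne i j with rfl | hij <;> simp [*]

end Protocol

/-! ### Binary expansions -/

open Classical in
/-- The number in `[0, 1]` whose binary digits are those of `y` after the first `i` ones. -/
def binTail (y : ℝ) (i : ℕ) : ℝ := if 1 ≤ y then 1 else Int.fract (y * 2 ^ i)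

lemma binTail_mem (y : ℝ) (i : ℕ) : binTail y i ∈ Set.Icc (0 : ℝ) 1 := by
  unfold binTail
  split_ifs
  · simp
  · exact ⟨Int.fract_nonneg _, (Int.fract_lt_one _).le⟩

lemma binTail_zero {y : ℝ} (hy : y ∈ Set.Icc (0 : ℝ) 1) : binTail y 0 = y := by
  unfold binTail
  split_ifs with h
  · exact le_antisymm h hy.2
  · rw [pow_zero, mul_one, Int.fract_eq_self.2 ⟨hy.1, not_le.1 h⟩]

/-- Doubling shifts the expansion by one place. For `1 ≤ y` all digits and all tails are 1, and the
identity reads 2 = 1 + 1. -/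
lemma two_mul_binTail (y : ℝ) (i : ℕ) :
    2 * binTail y i = bitVal (binDigit y (i + 1)) + binTail y (i + 1) := by
  unfold binTail binDigit bitVal
  by_cases h : 1 ≤ y
  · simp [h]; norm_num
  · simp only [h, if_false, false_or, decide_eq_true_eq]
    have hz : y * 2 ^ (i + 1) = 2 * (y * 2 ^ i) := by ring
    rw [hz]
    generalize y * 2 ^ i = z
    have h0 := Int.fract_nonneg z
    have h1 := Int.fract_lt_one z
    have hf : (⌊z⌋ : ℝ) = z - Int.fract z := by rw [← Int.floor_add_fract z]; simp
    rcases lt_or_ge (Int.fract z) (1 / 2) with hlt | hge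
    · have hfl : ⌊2 * z⌋ = 2 * ⌊z⌋ := by
        rw [Int.floor_eq_iff]; push_cast; rw [hf]; constructor <;> linarith
      rw [if_neg (by omega), Int.fract, Int.fract, hfl]
      push_cast; ring
    · have hfl : ⌊2 * z⌋ = 2 * ⌊z⌋ + 1 := by
        rw [Int.floor_eq_iff]; push_cast; rw [hf]; constructor <;> linarith
      rw [if_pos (by omega), Int.fract, Int.fract, hfl]
      push_cast; ring

/-- The truncation of `y ∈ [0, 1]` to `l` binary digits. -/
def binTrunc (y : ℝ) (l : ℕ) : ℝ := digitSum y l 1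

lemma binTrunc_eq {y : ℝ} (hy : y ∈ Set.Icc (0 : ℝ) 1) (l : ℕ) :
    binTrunc y l = y - binTail y l / 2 ^ l := by
  induction l with
  | zero => simp [binTrunc, digitSum, binTail_zero hy]
  | succ l ih =>
    have h := two_mul_binTail y l
    rw [binTrunc, digitSum, Finset.sum_range_succ, ← digitSum, ← binTrunc, ih, add_comm 1 l]
    rw [show binTail y l = (bitVal (binDigit y (l + 1)) + binTail y (l + 1)) / 2 by linarith]
    field_simp
    ring

/-- What has been received of the digits of `y` before round `k`. -/
def truncBefore (y : ℝ) (first k : ℕ) : ℝ := if k = 1 then 0 else binTrunc y (first + k - 1)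

lemma truncBefore_add_digitSum (y : ℝ) (first k : ℕ) (hk : 1 ≤ k) :
    truncBefore y first k + digitSum y (batchSize first k) (batchStart first k) =
      binTrunc y (first + k) := by
  unfold truncBefore batchSize batchStart
  split_ifs with h
  · subst h; simp [binTrunc]
  · obtain ⟨k, rfl⟩ := Nat.exists_eq_add_of_le' hk
    rw [show first + (k + 1) - 1 = first + k by omega, ← add_assoc, binTrunc, binTrunc, digitSum,
      digitSum, digitSum, Finset.sum_range_succ, Finset.sum_range_succ]
    simp [add_comm 1]

lemma truncBefore_succ (y : ℝ) (first k : ℕ) (hk : 1 ≤ k) :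
    truncBefore y first (k + 1) = binTrunc y (first + k) := by
  rw [truncBefore, if_neg (by omega), ← add_assoc, Nat.add_sub_cancel]

/-! ### Mixtures -/

/-- The mean of a variable with the value `A` with probability `p` and `B` otherwise. -/
def mix (p : ℝ) (A B : ℝ≥0∞) : ℝ≥0∞ := ENNReal.ofReal p * A + ENNReal.ofReal (1 - p) * B

@[simp] lemma mix_one (A B : ℝ≥0∞) : mix 1 A B = A := by simp [mix]

@[simp] lemma mix_zero (A B : ℝ≥0∞) : mix 0 A B = B := by simp [mix]

lemma mix_average {p q r : ℝ} (hp : p ∈ Set.Icc (0 : ℝ) 1) (hq : q ∈ Set.Icc (0 : ℝ) 1)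
    (hr : 2 * r = p + q) (A B : ℝ≥0∞) : (mix p A B + mix q A B) / 2 = mix r A B := by
  have h1 : ENNReal.ofReal r = (ENNReal.ofReal p + ENNReal.ofReal q) / 2 := by
    rw [← ENNReal.ofReal_add hp.1 hq.1, ← hr, ENNReal.ofReal_mul (by norm_num)]
    rw [mul_comm, mul_div_assoc]
    simp [ENNReal.div_self]
  have h2 : ENNReal.ofReal (1 - r) = (ENNReal.ofReal (1 - p) + ENNReal.ofReal (1 - q)) / 2 := by
    rw [← ENNReal.ofReal_add (by linarith [hp.2]) (by linarith [hq.2]),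
      show 1 - p + (1 - q) = 2 * (1 - r) by linarith, ENNReal.ofReal_mul (by norm_num)]
    rw [mul_comm, mul_div_assoc]
    simp [ENNReal.div_self]
  rw [mix, mix, mix, h1, h2]
  simp only [ENNReal.div_eq_inv_mul]
  ring

lemma add_mix {p : ℝ} (hp : p ∈ Set.Icc (0 : ℝ) 1) (c A B : ℝ≥0∞) :
    c + mix p A B = mix p (c + A) (c + B) := by
  have h : ENNReal.ofReal p + ENNReal.ofReal (1 - p) = 1 := by
    rw [← ENNReal.ofReal_add hp.1 (by linarith [hp.2])]; simp
  calc c + mix p A B = (ENNReal.ofReal p + ENNReal.ofReal (1 - p)) * c + mix p A B := by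
        rw [h, one_mul]
    _ = _ := by rw [mix, mix]; ring

/-- The mean of a variable that is decided by comparing coins with binary digits: `A` if the
number formed by the coins is below the tail of `y`, and `B` otherwise. -/
lemma mix_binTail (y : ℝ) (i : ℕ) (A B : ℝ≥0∞) :
    ((if true = binDigit y (i + 1) then mix (binTail y (i + 1)) A B else B) +
      (if false = binDigit y (i + 1) then mix (binTail y (i + 1)) A B else A)) / 2 =
      mix (binTail y i) A B := by
  have h := two_mul_binTail y i
  cases hd : binDigit y (i + 1)
  · rw [hd] at h
    simp only [Bool.true_eq_false, if_false, if_true]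
    simpa only [mix_zero] using mix_average (p := 0) (by simp) (binTail_mem y (i + 1)) h A B
  · rw [hd] at h
    simp only [Bool.false_eq_true, if_false, if_true]
    rw [add_comm]
    simpa only [mix_one] using mix_average (p := 1) (by simp) (binTail_mem y (i + 1)) h A B

/-! ### Comparing a random number with a threshold -/

/-- The probability that a random number that is uniform in `[U, U + 2 ^ (1 - k)]` is at most
`r`. -/
def below (r : ℝ) (k : ℕ) (U : ℝ) : ℝ := max 0 (min 1 ((r - U) * 2 ^ k / 2))

lemma below_mem (r : ℝ) (k : ℕ) (U : ℝ) : below r k U ∈ Set.Icc (0 : ℝ) 1 :=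
  ⟨le_max_left _ _, max_le zero_le_one (min_le_left _ _)⟩

lemma below_start {r : ℝ} (hr : r ∈ Set.Icc (0 : ℝ) 1) : below r 1 0 = r := by
  rw [below, sub_zero, pow_one, mul_div_assoc, div_self two_ne_zero, mul_one, min_eq_right hr.2,
    max_eq_right hr.1]

/-- The next digit halves the interval, so the probability is the average over the halves. After
rescaling this is 2 clamp(z) = clamp(2z - 1) + clamp(2z). -/
lemma two_mul_below (r : ℝ) (k : ℕ) (U : ℝ) :
    2 * below r k U = below r (k + 1) (U + bitVal true / 2 ^ k) +
      below r (k + 1) (U + bitVal false / 2 ^ k) := by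
  have h2 : (0 : ℝ) < 2 ^ k := by positivity
  have e1 : (r - (U + bitVal true / 2 ^ k)) * 2 ^ (k + 1) / 2 = 2 * ((r - U) * 2 ^ k / 2) - 1 := by
    simp only [bitVal, if_true]; field_simp; ring
  have e2 : (r - (U + bitVal false / 2 ^ k)) * 2 ^ (k + 1) / 2 = 2 * ((r - U) * 2 ^ k / 2) := by
    simp only [bitVal]; field_simp; ring_nf; simp
  rw [below, below, below, e1, e2]
  generalize (r - U) * 2 ^ k / 2 = z
  simp only [max_def, min_def]
  split_ifs <;> linarith

lemma below_eq_one {r U : ℝ} {k : ℕ} (h : U + 1 / 2 ^ k ≤ r) : below r (k + 1) U = 1 := by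
  have h2 : (0 : ℝ) < 2 ^ k := by positivity
  have : 1 ≤ (r - U) * 2 ^ (k + 1) / 2 := by
    have h3 : 1 / 2 ^ k ≤ r - U := by linarith
    rw [div_le_iff₀ h2] at h3
    rw [pow_succ]; linarith
  rw [below, min_eq_left this]; simp

lemma below_eq_zero {r U : ℝ} {k : ℕ} (h : r ≤ U) : below r k U = 0 := by
  have : (r - U) * 2 ^ k / 2 ≤ 0 := by
    have h2 : (0 : ℝ) < 2 ^ k := by positivity
    have := mul_nonpos_of_nonpos_of_nonneg (sub_nonpos.2 h) h2.le
    linarith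
  rw [below, max_eq_left ((min_le_right _ _).trans this)]

open Classical in
/-- The probability that a loop, whose round `k` adds a random `k`-th binary digit to `U` and stops
unless `go k U`, does not stop in `d` rounds. -/
def goProb (go : ℕ → ℝ → Prop) : (d k : ℕ) → (U : ℝ) → ℝ≥0∞
  | 0, _, _ => 1
  | d + 1, k, U =>
    ((if go k (U + bitVal true / 2 ^ k) then goProb go d (k + 1) (U + bitVal true / 2 ^ k) else 0) +
    (if go k (U + bitVal false / 2 ^ k) then goProb go d (k + 1) (U + bitVal false / 2 ^ k) else 0))
      / 2

/-- The expected number of rounds of the loop. -/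
def loopRounds (go : ℕ → ℝ → Prop) (k : ℕ) (U : ℝ) : ℝ≥0∞ := ∑' d, goProb go d k U

open Classical in
lemma loopRounds_eq (go : ℕ → ℝ → Prop) (k : ℕ) (U : ℝ) :
    loopRounds go k U = 1 +
      ((if go k (U + bitVal true / 2 ^ k) then loopRounds go (k + 1) (U + bitVal true / 2 ^ k)
        else 0) +
      (if go k (U + bitVal false / 2 ^ k) then loopRounds go (k + 1) (U + bitVal false / 2 ^ k)
        else 0)) / 2 := by
  rw [loopRounds, tsum_eq_zero_add' ENNReal.summable]
  · have h : ∀ U', (if go k U' then loopRounds go (k + 1) U' else 0) =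
        ∑' d, if go k U' then goProb go d (k + 1) U' else 0 := by
      intro U'
      split_ifs <;> simp [loopRounds]
    rw [h, h, ← ENNReal.tsum_add]
    simp only [goProb, ENNReal.div_eq_inv_mul, ENNReal.tsum_mul_left]

lemma goProb_le_one (go : ℕ → ℝ → Prop) (d k : ℕ) (U : ℝ) : goProb go d k U ≤ 1 := by
  classical
  induction d generalizing k U with
  | zero => exact le_rfl
  | succ d ih =>
    rw [goProb]
    have h : ∀ U', (if go k U' then goProb go d (k + 1) U' else 0) ≤ 1 := by
      intro U'; split_ifs
      · exact ih _ _
      · exact zero_le_one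
    refine (ENNReal.div_le_div_right (add_le_add (h _) (h _)) 2).trans ?_
    rw [one_add_one_eq_two, ENNReal.div_self] <;> simp

open Classical in
-- Surviving `d + 1` rounds implies being undecided in the last one; the earlier conditions are
-- dropped. In that round the partial random number is uniform on the grid.
lemma goProb_le_count (go : ℕ → ℝ → Prop) (d k : ℕ) (U : ℝ) :
    goProb go (d + 1) k U ≤
      ((Finset.range (2 ^ (d + 1))).filter fun j : ℕ => go (k + d) (U + j / 2 ^ (k + d))).card
        / 2 ^ (d + 1) := by
  induction d generalizing k U with
  | zero =>
    rw [goProb]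
    simp only [goProb, zero_add, pow_one, add_zero, bitVal]
    refine ENNReal.div_le_div_right ?_ _
    rw [Finset.card_filter, show (2 : ℕ) = 1 + 1 from rfl, Finset.sum_range_succ,
      Finset.sum_range_one]
    push_cast
    simp [add_comm]
  | succ d ih =>
    rw [goProb]
    have h : ∀ U', (if go k U' then goProb go (d + 1) (k + 1) U' else 0) ≤
        ((Finset.range (2 ^ (d + 1))).filter fun j : ℕ =>
          go (k + (d + 1)) (U' + j / 2 ^ (k + (d + 1)))).card / 2 ^ (d + 1) := by
      intro U'
      split_ifs
      · refine (ih _ _).trans (le_of_eq ?_)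
        rw [show k + 1 + d = k + (d + 1) by ring]
      · exact zero_le
    refine (ENNReal.div_le_div_right (add_le_add (h _) (h _)) 2).trans (le_of_eq ?_)
    rw [← ENNReal.add_div, ENNReal.div_eq_inv_mul, ENNReal.div_eq_inv_mul, ENNReal.div_eq_inv_mul,
      ← mul_assoc, ← ENNReal.mul_inv (by simp) (by simp), ← pow_succ']
    congr 1
    rw [Finset.card_filter, Finset.card_filter, Finset.card_filter, pow_succ' 2 (d + 1), two_mul,
      Finset.sum_range_add]
    push_cast
    rw [add_comm]
    -- The first coin is the leading digit of the index, so `true` corresponds to the upper half of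
    -- the range.
    have hb : ∀ j : ℕ, U + bitVal true / 2 ^ k + j / 2 ^ (k + (d + 1)) =
        U + (2 ^ (d + 1) + (j : ℝ)) / 2 ^ (k + (d + 1)) := by
      intro j
      rw [pow_add]; simp only [bitVal, if_true]; field_simp; ring
    have hb' : U + bitVal false / 2 ^ k = U := by simp [bitVal]
    simp only [hb, hb']

/-- The expected price of the loop with the price `c` per round, if it ends with `A` when the
random number is at most `r`, and with `B` when it is larger. -/
def loopValue (go : ℕ → ℝ → Prop) (r : ℝ) (c A B : ℝ≥0∞) (k : ℕ) (U : ℝ) : ℝ≥0∞ :=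
  mix (below r k U) A B + c * loopRounds go k U

open Classical in
-- The loop stops only when the threshold is outside the interior of the current dyadic interval.
-- There `below` is already 1 or 0, so stopping early gives the same mean as an exact comparison.
lemma loopValue_step (yes no : ℕ → ℝ → Prop) (r : ℝ) (c A B : ℝ≥0∞) (k : ℕ) (U : ℝ)
    (hyes : ∀ b, yes k (U + bitVal b / 2 ^ k) → U + bitVal b / 2 ^ k + 1 / 2 ^ k ≤ r)
    (hno : ∀ b, no k (U + bitVal b / 2 ^ k) → r ≤ U + bitVal b / 2 ^ k)
    {v : Bool → ℝ≥0∞}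
    (hv : ∀ b, v b ≤ if yes k (U + bitVal b / 2 ^ k) then A else
      if no k (U + bitVal b / 2 ^ k) then B else
      loopValue (fun k U => ¬ yes k U ∧ ¬ no k U) r c A B (k + 1) (U + bitVal b / 2 ^ k)) :
    c + (v true + v false) / 2 ≤ loopValue (fun k U => ¬ yes k U ∧ ¬ no k U) r c A B k U := by
  set go : ℕ → ℝ → Prop := fun k U => ¬ yes k U ∧ ¬ no k U with hgo
  have h : ∀ b, v b ≤ mix (below r (k + 1) (U + bitVal b / 2 ^ k)) A B +
      c * (if go k (U + bitVal b / 2 ^ k) then loopRounds go (k + 1) (U + bitVal b / 2 ^ k)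
        else 0) := by
    intro b
    refine (hv b).trans ?_
    by_cases h1 : yes k (U + bitVal b / 2 ^ k)
    · simp [hgo, h1, below_eq_one (hyes b h1)]
    · by_cases h2 : no k (U + bitVal b / 2 ^ k)
      · simp [hgo, h1, h2, below_eq_zero (hno b h2)]
      · simp [hgo, h1, h2, loopValue]
  refine (add_le_add le_rfl (ENNReal.div_le_div_right (add_le_add (h true) (h false)) 2)).trans
    (le_of_eq ?_)
  rw [loopValue, loopRounds_eq go k U,
    ← mix_average (below_mem _ _ _) (below_mem _ _ _) (two_mul_below r k U) A B]
  simp only [ENNReal.div_eq_inv_mul]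
  ring_nf

/-- Finitely many natural numbers with distances at most `l` are at most `l + 1` many. -/
lemma card_le_of_sub_le (s : Finset ℕ) (l : ℕ) (h : ∀ i ∈ s, ∀ j ∈ s, j ≤ i + l) :
    s.card ≤ l + 1 := by
  rcases s.eq_empty_or_nonempty with rfl | hs
  · simp
  · refine (Finset.card_le_card (t := Finset.Icc (s.min' hs) (s.min' hs + l)) fun i hi => ?_).trans
      ?_
    · exact Finset.mem_Icc.2 ⟨Finset.min'_le _ _ hi, h _ (Finset.min'_mem _ _) _ hi⟩
    · rw [Nat.card_Icc]; omega

/-! ### The GHZ distribution -/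

lemma VNMeasurement.cosAmp_sq (M : VNMeasurement) (x : ℤˣ) :
    cosAmp M x ^ 2 = (1 + ((x : ℤ) : ℝ) * Real.sin M.φ) / 2 := by
  rw [cosAmp, Real.cos_sq, mul_div_cancel₀ _ two_ne_zero]
  rcases Int.units_eq_one_or x with rfl | rfl
  · simp [Real.cos_sub_pi_div_two]; ring
  · simp [Real.cos_add_pi_div_two]; ring

lemma VNMeasurement.sinAmp_sq (M : VNMeasurement) (x : ℤˣ) :
    sinAmp M x ^ 2 = (1 - ((x : ℤ) : ℝ) * Real.sin M.φ) / 2 := by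
  have h := M.cosAmp_sq x
  rw [sinAmp, neg_sq, Real.sin_sq, ← cosAmp, h]
  ring

lemma VNMeasurement.cosAmp_mul_sinAmp (M : VNMeasurement) (x : ℤˣ) :
    cosAmp M x * sinAmp M x = ((x : ℤ) : ℝ) * Real.cos M.φ / 2 := by
  have h : cosAmp M x * sinAmp M x = -Real.sin (M.φ - Real.pi / 2 * ((x : ℤ) : ℝ)) / 2 := by
    conv_rhs => rw [← mul_div_cancel₀ (M.φ - Real.pi / 2 * ((x : ℤ) : ℝ)) (two_ne_zero (α := ℝ)),
      Real.sin_two_mul]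
    rw [cosAmp, sinAmp]
    ring
  rw [h]
  rcases Int.units_eq_one_or x with rfl | rfl
  · simp [Real.sin_sub_pi_div_two]
  · simp [Real.sin_add_pi_div_two]

lemma VNMeasurement.cosAmp_neg_sq (M : VNMeasurement) (x : ℤˣ) :
    cosAmp M (-x) ^ 2 = sinAmp M x ^ 2 := by
  rw [M.cosAmp_sq, M.sinAmp_sq]; push_cast; ring

section GHZ

variable {n : ℕ} (M : Fin n → VNMeasurement) (x : Fin n → ℤˣ)

/-- `a₁(x)`. -/
def cosProd : ℝ := ∏ j, cosAmp (M j) (x j)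

/-- `a₂(x)`. -/
def sinProd : ℝ := ∏ j, sinAmp (M j) (x j)

/-- `p₁(x)` for `B = true` and `p₂(x)` for `B = false`. -/
def branchProb (B : Bool) : ℝ := (cosProd M x + (if B then sinProd M x else -sinProd M x)) ^ 2 / 2

/-- Twice the law of the tentative sample. -/
def envelope : ℝ := cosProd M x ^ 2 + sinProd M x ^ 2

/-- The parameter of the Bernoulli bit. -/
def branchParam : ℝ := Real.cos (∑ j, (M j).θ / 2) ^ 2

lemma branchParam_mem : branchParam M ∈ Set.Icc (0 : ℝ) 1 :=
  ⟨sq_nonneg _, Real.cos_sq_le_one _⟩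

lemma VNMeasurement.projector_zero_zero (M : VNMeasurement) (x : ℤˣ) :
    M.projector x 0 0 = ((cosAmp M x ^ 2 : ℝ) : ℂ) := by
  rw [M.cosAmp_sq]
  simp [VNMeasurement.projector, VNMeasurement.observable]
  ring

lemma VNMeasurement.projector_one_one (M : VNMeasurement) (x : ℤˣ) :
    M.projector x 1 1 = ((sinAmp M x ^ 2 : ℝ) : ℂ) := by
  rw [M.sinAmp_sq]
  simp [VNMeasurement.projector, VNMeasurement.observable]
  ring

lemma VNMeasurement.projector_zero_one (M : VNMeasurement) (x : ℤˣ) :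
    M.projector x 0 1 = ((cosAmp M x * sinAmp M x : ℝ) : ℂ) *
      Complex.exp (-(M.θ * Complex.I)) := by
  rw [M.cosAmp_mul_sinAmp]
  simp [VNMeasurement.projector, VNMeasurement.observable]
  ring

lemma VNMeasurement.projector_one_zero (M : VNMeasurement) (x : ℤˣ) :
    M.projector x 1 0 = ((cosAmp M x * sinAmp M x : ℝ) : ℂ) *
      Complex.exp (M.θ * Complex.I) := by
  rw [M.cosAmp_mul_sinAmp]
  simp [VNMeasurement.projector, VNMeasurement.observable]
  ring

/-- The state has two nonzero entries, so four products remain. The diagonal ones are the two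
squares; the off-diagonal ones carry the phases e^{∓iθ}, which add up to a cosine. -/
lemma ghzProb_eq : ghzProb M x =
    (cosProd M x ^ 2 + sinProd M x ^ 2) / 2 +
      cosProd M x * sinProd M x * Real.cos (∑ j, (M j).θ) := by
  have h1 : dotProduct (star (ghzState n)) ((jointProjector M x).mulVec (ghzState n)) =
      (1 / 2 : ℂ) * (∏ j, (M j).projector (x j) 0 0 + ∏ j, (M j).projector (x j) 0 1 +
        (∏ j, (M j).projector (x j) 1 0 + ∏ j, (M j).projector (x j) 1 1)) := by
    have hs : (((Real.sqrt 2)⁻¹ : ℝ) : ℂ) * (((Real.sqrt 2)⁻¹ : ℝ) : ℂ) = 1 / 2 := by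
      rw [← Complex.ofReal_mul, ← mul_inv, Real.mul_self_sqrt (by norm_num)]
      norm_num
    have hmv : ∀ b, (jointProjector M x).mulVec (ghzState n) b = (((Real.sqrt 2)⁻¹ : ℝ) : ℂ) *
        (∏ j, (M j).projector (x j) (b j) 0 + ∏ j, (M j).projector (x j) (b j) 1) := by
      intro b
      simp only [Matrix.mulVec, dotProduct, jointProjector, ghzState, Matrix.of_apply, mul_add,
        mul_ite, mul_one, mul_zero, Finset.sum_add_distrib, Finset.sum_ite_eq', Finset.mem_univ,
        if_true]
      ring
    have hst : ∀ b, star (ghzState n) b = ghzState n b := by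
      intro b
      simp only [Pi.star_apply, ghzState, star_mul', RCLike.star_def, Complex.conj_ofReal, star_add]
      congr 2 <;> split_ifs <;> simp
    simp only [dotProduct, hmv, hst]
    simp only [ghzState, mul_add, add_mul,
        mul_ite, ite_mul, mul_one, mul_zero, zero_mul, Finset.sum_add_distrib, Finset.sum_ite_eq',
        Finset.mem_univ, if_true, ← mul_assoc, hs]
    ring
  have he1 : ∏ j, Complex.exp (-(((M j).θ : ℂ) * Complex.I)) =
      Complex.exp (-(((∑ j, (M j).θ : ℝ) : ℂ) * Complex.I)) := by
    rw [← Complex.exp_sum, Complex.ofReal_sum, Finset.sum_mul, Finset.sum_neg_distrib]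
  have he2 : ∏ j, Complex.exp (((M j).θ : ℂ) * Complex.I) =
      Complex.exp (((∑ j, (M j).θ : ℝ) : ℂ) * Complex.I) := by
    rw [← Complex.exp_sum, Complex.ofReal_sum, Finset.sum_mul]
  have hc : ∏ j, cosAmp (M j) (x j) = cosProd M x := rfl
  have hs : ∏ j, sinAmp (M j) (x j) = sinProd M x := rfl
  rw [ghzProb, h1]
  simp only [VNMeasurement.projector_zero_zero, VNMeasurement.projector_zero_one,
    VNMeasurement.projector_one_zero, VNMeasurement.projector_one_one, Finset.prod_mul_distrib,
    he1, he2, ← Complex.ofReal_prod, Finset.prod_pow, hc, hs]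
  have h2 : (1 / 2 : ℂ) * (((cosProd M x ^ 2 : ℝ) : ℂ) +
      ((cosProd M x * sinProd M x : ℝ) : ℂ) * Complex.exp (-(((∑ j, (M j).θ : ℝ) : ℂ) * Complex.I)) +
      (((cosProd M x * sinProd M x : ℝ) : ℂ) * Complex.exp (((∑ j, (M j).θ : ℝ) : ℂ) * Complex.I) +
        ((sinProd M x ^ 2 : ℝ) : ℂ))) =
      (((cosProd M x ^ 2 + sinProd M x ^ 2) / 2 +
      cosProd M x * sinProd M x * Real.cos (∑ j, (M j).θ) : ℝ) : ℂ) := by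
    push_cast
    rw [Complex.cos, neg_mul]
    ring
  rw [h2, Complex.ofReal_re]

/-- Use cos θ = cos²(θ/2) - sin²(θ/2): the terms ±a₁a₂ are the cross terms of the two squares. -/
lemma ghzProb_eq_mix : ghzProb M x =
    branchParam M * branchProb M x true + (1 - branchParam M) * branchProb M x false := by
  rw [ghzProb_eq, branchParam, branchProb, branchProb, Real.cos_sq, ← Finset.sum_div,
    mul_div_cancel₀ _ two_ne_zero]
  simp
  ring

lemma branchProb_nonneg (B : Bool) : 0 ≤ branchProb M x B := by
  unfold branchProb; positivity

lemma envelope_nonneg : 0 ≤ envelope M x := by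
  unfold envelope; positivity

/-- The difference is half the square with the opposite sign. This domination is what rejection
sampling needs. -/
lemma branchProb_le_envelope (B : Bool) : branchProb M x B ≤ envelope M x := by
  unfold branchProb envelope
  cases B
  · simp only [Bool.false_eq_true, if_false]; nlinarith [sq_nonneg (cosProd M x + sinProd M x)]
  · simp only [if_true]; nlinarith [sq_nonneg (cosProd M x - sinProd M x)]

lemma sum_prod_units (f : Fin n → ℤˣ → ℝ) :
    ∑ x : Fin n → ℤˣ, ∏ j, f j (x j) = ∏ j, (f j 1 + f j (-1)) := by
  have h : ∀ j, f j 1 + f j (-1) = ∑ s, f j s := by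
    intro j
    rw [UnitsInt.univ, Finset.sum_pair (by decide)]
  simp only [h]
  rw [Finset.prod_univ_sum, Fintype.piFinset_univ]

lemma sum_envelope : ∑ x, envelope M x = 2 := by
  simp only [envelope, Finset.sum_add_distrib, cosProd, sinProd, ← Finset.prod_pow]
  rw [sum_prod_units fun j s => cosAmp (M j) s ^ 2, sum_prod_units fun j s => sinAmp (M j) s ^ 2]
  simp only [VNMeasurement.cosAmp_sq, VNMeasurement.sinAmp_sq]
  have h1 : ∀ a : ℝ, (1 + ((1 : ℤˣ) : ℤ) * a) / 2 + (1 + ((-1 : ℤˣ) : ℤ) * a) / 2 = 1 := by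
    intro a; push_cast; ring
  have h2 : ∀ a : ℝ, (1 - ((1 : ℤˣ) : ℤ) * a) / 2 + (1 - ((-1 : ℤˣ) : ℤ) * a) / 2 = 1 := by
    intro a; push_cast; ring
  simp only [h1, h2, Finset.prod_const_one]
  norm_num

/-- The sum factorizes over the parties and every factor vanishes; one factor must exist, hence `n ≠
0`. -/
lemma sum_cosProd_mul_sinProd (hn : n ≠ 0) : ∑ x, cosProd M x * sinProd M x = 0 := by
  simp only [cosProd, sinProd, ← Finset.prod_mul_distrib]
  rw [sum_prod_units fun j s => cosAmp (M j) s * sinAmp (M j) s]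
  simp only [VNMeasurement.cosAmp_mul_sinAmp]
  refine Finset.prod_eq_zero (Finset.mem_univ ⟨0, Nat.pos_of_ne_zero hn⟩) ?_
  push_cast; ring

lemma sum_branchProb (hn : n ≠ 0) (B : Bool) : ∑ x, branchProb M x B = 1 := by
  have h : ∀ x, branchProb M x B = envelope M x / 2 +
      (if B then 1 else -1) * (cosProd M x * sinProd M x) := by
    intro x
    unfold branchProb envelope
    cases B <;> simp <;> ring
  simp only [h, Finset.sum_add_distrib, ← Finset.mul_sum, ← Finset.sum_div, sum_envelope,
    sum_cosProd_mul_sinProd M hn]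
  norm_num

lemma ghzProb_nonneg : 0 ≤ ghzProb M x := by
  rw [ghzProb_eq_mix]
  have := branchParam_mem M
  have h1 := branchProb_nonneg M x true
  have h2 := branchProb_nonneg M x false
  have h3 : 0 ≤ 1 - branchParam M := by linarith [this.2]
  have h4 := this.1
  positivity

lemma sum_ghzProb (hn : n ≠ 0) : ∑ x, ghzProb M x = 1 := by
  simp only [ghzProb_eq_mix, Finset.sum_add_distrib, ← Finset.mul_sum, sum_branchProb M hn]
  ring

lemma VNMeasurement.abs_cosAmp_le_one (M : VNMeasurement) (x : ℤˣ) : |cosAmp M x| ≤ 1 :=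
  Real.abs_cos_le_one _

lemma VNMeasurement.abs_sinAmp_le_one (M : VNMeasurement) (x : ℤˣ) : |sinAmp M x| ≤ 1 := by
  rw [sinAmp, abs_neg]; exact Real.abs_sin_le_one _

end GHZ

/-! ### Errors of the approximations -/

lemma Finset.abs_prod_le_one {ι : Type*} (s : Finset ι) (f : ι → ℝ) (hf : ∀ i ∈ s, |f i| ≤ 1) :
    |∏ i ∈ s, f i| ≤ 1 := by
  rw [Finset.abs_prod]
  exact Finset.prod_le_one (fun _ _ => abs_nonneg _) hf

/-- The factors are exchanged one at a time, and the remaining ones have modulus at most 1. -/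
lemma Finset.abs_prod_sub_prod_le {ι : Type*} (s : Finset ι) (f g : ι → ℝ)
    (hf : ∀ i ∈ s, |f i| ≤ 1) (hg : ∀ i ∈ s, |g i| ≤ 1) :
    |∏ i ∈ s, f i - ∏ i ∈ s, g i| ≤ ∑ i ∈ s, |f i - g i| := by
  classical
  induction s using Finset.induction_on with
  | empty => simp
  | insert a s ha ih =>
    rw [Finset.prod_insert ha, Finset.prod_insert ha, Finset.sum_insert ha]
    have h1 := ih (fun i hi => hf i (Finset.mem_insert_of_mem hi))
      (fun i hi => hg i (Finset.mem_insert_of_mem hi))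
    have h2 := s.abs_prod_le_one f fun i hi => hf i (Finset.mem_insert_of_mem hi)
    have h3 := hg a (Finset.mem_insert_self ..)
    calc |f a * ∏ i ∈ s, f i - g a * ∏ i ∈ s, g i|
        = |(f a - g a) * ∏ i ∈ s, f i + g a * (∏ i ∈ s, f i - ∏ i ∈ s, g i)| := by ring_nf
      _ ≤ |f a - g a| * |∏ i ∈ s, f i| + |g a| * |∏ i ∈ s, f i - ∏ i ∈ s, g i| := by
        rw [← abs_mul, ← abs_mul]; exact abs_add_le _ _
      _ ≤ |f a - g a| * 1 + 1 * ∑ i ∈ s, |f i - g i| := by gcongr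
      _ = _ := by ring

lemma digitSum_nonneg (y : ℝ) (cnt i : ℕ) : 0 ≤ digitSum y cnt i := by
  refine Finset.sum_nonneg fun l _ => ?_
  unfold bitVal; split_ifs <;> positivity

lemma encodeSigned_mem {v : ℝ} (hv : |v| ≤ 1) : encodeSigned v ∈ Set.Icc (0 : ℝ) 1 := by
  rw [abs_le] at hv
  unfold encodeSigned
  constructor <;> linarith

lemma decodeSigned_binTrunc {v : ℝ} (hv : |v| ≤ 1) (l : ℕ) :
    decodeSigned (binTrunc (encodeSigned v) l) = v - 2 * (binTail (encodeSigned v) l / 2 ^ l) := by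
  rw [binTrunc_eq (encodeSigned_mem hv), decodeSigned, encodeSigned]
  ring

lemma abs_decodeSigned_binTrunc_sub_le {v : ℝ} (hv : |v| ≤ 1) (l : ℕ) :
    |decodeSigned (binTrunc (encodeSigned v) l) - v| ≤ 2 / 2 ^ l := by
  have h := binTail_mem (encodeSigned v) l
  have h0 : 0 ≤ binTail (encodeSigned v) l / 2 ^ l := div_nonneg h.1 (by positivity)
  have h1 : binTail (encodeSigned v) l / 2 ^ l ≤ 1 / 2 ^ l := by gcongr; exact h.2
  rw [decodeSigned_binTrunc hv, abs_le, show (2 : ℝ) / 2 ^ l = 2 * (1 / 2 ^ l) by ring]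
  constructor <;> linarith

lemma abs_decodeSigned_binTrunc_le_one {v : ℝ} (hv : |v| ≤ 1) (l : ℕ) :
    |decodeSigned (binTrunc (encodeSigned v) l)| ≤ 1 := by
  have h := binTail_mem (encodeSigned v) l
  have h0 : 0 ≤ binTail (encodeSigned v) l / 2 ^ l := div_nonneg h.1 (by positivity)
  rw [abs_le]
  constructor
  · rw [decodeSigned]
    have := digitSum_nonneg (encodeSigned v) l 1
    rw [← binTrunc] at this
    linarith
  · rw [decodeSigned_binTrunc hv]
    linarith [(abs_le.1 hv).2]

lemma natCast_div_two_pow_logParties_le (m k : ℕ) :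
    (m : ℝ) * (1 / 2 ^ (logParties m + k)) ≤ 1 / 2 ^ k := by
  have h : (m : ℝ) ≤ 2 ^ logParties m := by
    have := Nat.le_pow_clog one_lt_two (m + 1)
    exact_mod_cast (Nat.le_succ m).trans this
  rw [pow_add, mul_one_div, div_le_div_iff₀ (by positivity) (by positivity), one_mul]
  gcongr

section Approximations

variable {m : ℕ} (M : Fin (m + 1) → VNMeasurement) (x : Fin (m + 1) → ℤˣ)

/-- The approximation of `∏ j, f (M j) (x j)` in round `k` of the acceptance test. -/
def ampApprox (f : VNMeasurement → ℤˣ → ℝ) (k : ℕ) : ℝ :=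
  f (M 0) (x 0) *
    ∏ j : Fin m, decodeSigned (binTrunc (encodeSigned (f (M j.succ) (x j.succ))) (ampExtra m + k))

lemma abs_ampApprox_le_one {f : VNMeasurement → ℤˣ → ℝ} (hf : ∀ M x, |f M x| ≤ 1) (k : ℕ) :
    |ampApprox M x f k| ≤ 1 := by
  rw [ampApprox, abs_mul]
  exact mul_le_one₀ (hf _ _) (abs_nonneg _)
    (Finset.abs_prod_le_one _ _ fun j _ => abs_decodeSigned_binTrunc_le_one (hf _ _) _)

lemma abs_ampApprox_sub_le {f : VNMeasurement → ℤˣ → ℝ} (hf : ∀ M x, |f M x| ≤ 1) (k : ℕ) :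
    |ampApprox M x f k - ∏ j, f (M j) (x j)| ≤ 1 / 2 ^ k / 8 := by
  rw [ampApprox, Fin.prod_univ_succ, ← mul_sub, abs_mul]
  have h1 := Finset.abs_prod_sub_prod_le Finset.univ
    (fun j : Fin m =>
      decodeSigned (binTrunc (encodeSigned (f (M j.succ) (x j.succ))) (ampExtra m + k)))
    (fun j => f (M j.succ) (x j.succ)) (fun j _ => abs_decodeSigned_binTrunc_le_one (hf _ _) _)
    (fun j _ => hf _ _)
  have h2 : ∑ j : Fin m, |decodeSigned (binTrunc (encodeSigned (f (M j.succ) (x j.succ)))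
      (ampExtra m + k)) - f (M j.succ) (x j.succ)| ≤ m * (2 / 2 ^ (ampExtra m + k)) := by
    refine (Finset.sum_le_sum fun j _ => abs_decodeSigned_binTrunc_sub_le (hf _ _) _).trans ?_
    simp
  have h3 : (m : ℝ) * (2 / 2 ^ (ampExtra m + k)) ≤ 1 / 2 ^ k / 8 := by
    have := natCast_div_two_pow_logParties_le m k
    -- `logParties m` digits absorb the number of summands. Of the other four, one makes up for the
    -- factor 2 of the signed encoding and three leave the factor 1/8.
    rw [ampExtra, show 4 + logParties m + k = logParties m + k + 4 by ring, pow_add]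
    have h4 : (m : ℝ) * (2 / (2 ^ (logParties m + k) * 2 ^ 4)) =
      (m * (1 / 2 ^ (logParties m + k))) / 8 := by
      field_simp; norm_num
    rw [h4]
    gcongr
  calc _ ≤ 1 * _ := mul_le_mul_of_nonneg_right (hf _ _) (abs_nonneg _)
    _ ≤ _ := by rw [one_mul]; exact h1.trans (h2.trans h3)

/-- The approximation of the parameter of the Bernoulli bit in round `k`. -/
def paramApprox (k : ℕ) : ℝ :=
  Real.cos ((M 0).θ / 2 +
    ∑ j : Fin m, decodeAngle (binTrunc (encodeAngle (M j.succ).θ) (angleExtra m + k))) ^ 2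

lemma abs_cos_sq_sub_cos_sq_le (a b : ℝ) : |Real.cos a ^ 2 - Real.cos b ^ 2| ≤ |a - b| := by
  rw [Real.cos_sq, Real.cos_sq,
    show 1 / 2 + Real.cos (2 * a) / 2 - (1 / 2 + Real.cos (2 * b) / 2) =
      (Real.cos (2 * a) - Real.cos (2 * b)) / 2 by ring, abs_div, abs_two,
    div_le_iff₀ two_pos]
  refine (Real.abs_cos_sub_cos_le _ _).trans (le_of_eq ?_)
  rw [← mul_sub, abs_mul, abs_two, mul_comm]

lemma VNMeasurement.encodeAngle_mem (M : VNMeasurement) : encodeAngle M.θ ∈ Set.Icc (0 : ℝ) 1 := by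
  have h := M.hθ
  have := Real.pi_le_four
  unfold encodeAngle
  constructor
  · linarith [h.1]
  · linarith [h.2]

lemma abs_paramApprox_sub_le (k : ℕ) : |paramApprox M k - branchParam M| ≤ 1 / 2 ^ k := by
  rw [paramApprox, branchParam, Fin.sum_univ_succ]
  refine (abs_cos_sq_sub_cos_sq_le _ _).trans ?_
  rw [add_sub_add_left_eq_sub, ← Finset.sum_sub_distrib]
  refine (Finset.abs_sum_le_sum_abs _ _).trans ?_
  have h : ∀ j : Fin m, |decodeAngle (binTrunc (encodeAngle (M j.succ).θ) (angleExtra m + k)) -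
      (M j.succ).θ / 2| ≤ 1 / 2 ^ (logParties m + k) := by
    intro j
    have h0 := binTail_mem (encodeAngle (M j.succ).θ) (angleExtra m + k)
    rw [binTrunc_eq (M j.succ).encodeAngle_mem, decodeAngle]
    have h1 : 8 * (encodeAngle (M j.succ).θ - binTail (encodeAngle (M j.succ).θ)
        (angleExtra m + k) / 2 ^ (angleExtra m + k)) - (M j.succ).θ / 2 =
        -(binTail (encodeAngle (M j.succ).θ) (angleExtra m + k) / 2 ^ (logParties m + k)) := by
      rw [encodeAngle, angleExtra, show 3 + logParties m + k = logParties m + k + 3 by ring,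
        pow_add _ _ 3]
      field_simp
      ring
    rw [h1, abs_neg, abs_of_nonneg (div_nonneg h0.1 (by positivity))]
    gcongr
    exact h0.2
  refine (Finset.sum_le_sum fun j _ => h j).trans ?_
  simpa using natCast_div_two_pow_logParties_le m k

end Approximations

/-- The test function is (U - 1/2)(a² + b²) - ab. Its difference quotients in `a` and in `b` are at
most 2, because |U - 1/2| ≤ 1/2. -/
lemma abs_test_sub_test_le {U a b a' b' d : ℝ} (hU : U ∈ Set.Icc (0 : ℝ) 1) (ha : |a| ≤ 1)
    (hb : |b| ≤ 1) (ha' : |a'| ≤ 1) (hb' : |b'| ≤ 1) (hda : |a' - a| ≤ d) (hdb : |b' - b| ≤ d) :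
    |(U * (a' ^ 2 + b' ^ 2) - (a' + b') ^ 2 / 2) - (U * (a ^ 2 + b ^ 2) - (a + b) ^ 2 / 2)|
      ≤ 4 * d := by
  have h : (U * (a' ^ 2 + b' ^ 2) - (a' + b') ^ 2 / 2) - (U * (a ^ 2 + b ^ 2) - (a + b) ^ 2 / 2) =
      (a' - a) * ((U - 1 / 2) * (a' + a) - b') + (b' - b) * ((U - 1 / 2) * (b' + b) - a) := by ring
  have hU' : |U - 1 / 2| ≤ 1 / 2 := by
    rw [abs_le]; constructor <;> linarith [hU.1, hU.2]
  have key : ∀ {u v w : ℝ}, |u| ≤ 1 → |v| ≤ 1 → |w| ≤ 1 → |(U - 1 / 2) * (u + v) - w| ≤ 2 := by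
    intro u v w hu hv hw
    calc |(U - 1 / 2) * (u + v) - w| ≤ |(U - 1 / 2) * (u + v)| + |w| := abs_sub _ _
      _ ≤ 1 / 2 * (1 + 1) + 1 := by
        rw [abs_mul]
        gcongr
        exact (abs_add_le _ _).trans (add_le_add hu hv)
      _ = 2 := by norm_num
  have hd : 0 ≤ d := (abs_nonneg _).trans hda
  rw [h]
  calc _ ≤ |a' - a| * |(U - 1 / 2) * (a' + a) - b'| + |b' - b| * |(U - 1 / 2) * (b' + b) - a| := by
        rw [← abs_mul, ← abs_mul]; exact abs_add_le _ _
    _ ≤ d * 2 + d * 2 := by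
        gcongr
        · exact key ha' ha hb'
        · exact key hb' hb ha
    _ = _ := by ring

/-! ### The programs of the protocol -/

section Programs

variable {m : ℕ}

open Classical in
lemma ghzLeader_bern (M : VNMeasurement) (k : ℕ) (U : ℝ) (y : Fin m → ℝ) :
    ghzLeader m M (.bern k U y) = .toss fun b =>
      (forAll (fun j => recvDigits j (batchSize (angleExtra m) k)
        (batchStart (angleExtra m) k) (y j)) (List.finRange m) y).bind fun y' =>
      if U + bitVal b / 2 ^ k ≤
          Real.cos (M.θ / 2 + ∑ j, decodeAngle (y' j)) ^ 2 - 2 / 2 ^ k then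
        (sendAll false (List.finRange m)).bind fun _ => .done (.inl (.trial true))
      else if U + bitVal b / 2 ^ k ≥
          Real.cos (M.θ / 2 + ∑ j, decodeAngle (y' j)) ^ 2 + 1 / 2 ^ k then
        (sendAll false (List.finRange m)).bind fun _ => .done (.inl (.trial false))
      else
        (sendAll true (List.finRange m)).bind fun _ =>
          .done (.inl (.bern (k + 1) (U + bitVal b / 2 ^ k) y')) := rfl

lemma ghzLeader_trial (M : VNMeasurement) (B : Bool) :
    ghzLeader m M (.trial B) = .toss fun S =>
      (sendAll S (List.finRange m)).bind fun _ => .done (.inl (.rademacher B S 1)) := rfl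

lemma ghzLeader_rademacher (M : VNMeasurement) (B S : Bool) (i : ℕ) :
    ghzLeader m M (.rademacher B S i) = .toss fun V =>
      if V = binDigit (radParam M) i then .done (.inl (.rademacher B S (i + 1)))
      else .done (.inl (.deal B (if S then -(if V then -1 else 1) else if V then -1 else 1)
        (List.finRange m))) := rfl

lemma ghzLeader_deal_nil (M : VNMeasurement) (B : Bool) (X : ℤˣ) :
    ghzLeader m M (.deal B X []) = .done (.inl (.test B X 1 0 fun _ => (0, 0))) := rfl

lemma ghzLeader_deal_cons (M : VNMeasurement) (B : Bool) (X : ℤˣ) (j : Fin m)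
    (js : List (Fin m)) :
    ghzLeader m M (.deal B X (j :: js)) = .toss fun V => .send j V (.recv j fun more =>
      .done (.inl (.deal B X (if more then j :: js else js)))) := rfl

open Classical in
lemma ghzLeader_test (M : VNMeasurement) (B : Bool) (X : ℤˣ) (k : ℕ) (U : ℝ)
    (y : Fin m → ℝ × ℝ) :
    ghzLeader m M (.test B X k U y) = .toss fun b =>
      (forAll (fun j =>
        (recvDigits j (batchSize (ampExtra m) k) (batchStart (ampExtra m) k) (y j).1).bind fun c =>
        (recvDigits j (batchSize (ampExtra m) k) (batchStart (ampExtra m) k) (y j).2).bind fun s =>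
        .done (c, s)) (List.finRange m) y).bind fun y' =>
      let a₁ := cosAmp M X * ∏ j, decodeSigned (y' j).1
      let a₂ := (if B then sinAmp M X else -sinAmp M X) * ∏ j, decodeSigned (y' j).2
      if (U + bitVal b / 2 ^ k) * (a₁ ^ 2 + a₂ ^ 2) - (a₁ + a₂) ^ 2 / 2 < -(4 / 2 ^ k) then
        (sendAll false (List.finRange m)).bind fun _ =>
        (sendAll true (List.finRange m)).bind fun _ => .done (.inr X)
      else if (U + bitVal b / 2 ^ k) * (a₁ ^ 2 + a₂ ^ 2) - (a₁ + a₂) ^ 2 / 2 > 4 / 2 ^ k then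
        (sendAll false (List.finRange m)).bind fun _ =>
        (sendAll false (List.finRange m)).bind fun _ => .done (.inl (.trial B))
      else
        (sendAll true (List.finRange m)).bind fun _ =>
          .done (.inl (.test B X (k + 1) (U + bitVal b / 2 ^ k) y')) := rfl

lemma ghzParty_bern (M : VNMeasurement) (k : ℕ) :
    ghzParty m M (.bern k) =
      (sendDigits (encodeAngle M.θ) (batchSize (angleExtra m) k)
        (batchStart (angleExtra m) k)).bind fun _ =>
      .recv fun more => .done (.inl (if more then .bern (k + 1) else .trial)) := rfl

lemma ghzParty_trial (M : VNMeasurement) :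
    ghzParty m M .trial = .recv fun S => .done (.inl (.rademacher S 1)) := rfl

lemma ghzParty_rademacher (M : VNMeasurement) (S : Bool) (i : ℕ) :
    ghzParty m M (.rademacher S i) = .recv fun V => .send (V == binDigit (radParam M) i)
      (if (V == binDigit (radParam M) i) = true then .done (.inl (.rademacher S (i + 1)))
      else .done (.inl
        (.test (if S then -(if V then -1 else 1) else if V then -1 else 1) 1))) := rfl

lemma ghzParty_test (M : VNMeasurement) (X : ℤˣ) (k : ℕ) :
    ghzParty m M (.test X k) =
      (sendDigits (encodeSigned (cosAmp M X)) (batchSize (ampExtra m) k)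
        (batchStart (ampExtra m) k)).bind fun _ =>
      (sendDigits (encodeSigned (sinAmp M X)) (batchSize (ampExtra m) k)
        (batchStart (ampExtra m) k)).bind fun _ =>
      .recv fun more => if more = true then .done (.inl (.test X (k + 1)))
        else .recv fun accepted => .done (if accepted = true then .inr X else .inl .trial) := rfl

lemma batchSize_pos (first k : ℕ) : 0 < batchSize first k := by
  unfold batchSize; split_ifs <;> omega

lemma sendDigits_bind_ne_done {α : Type} (y : ℝ) {cnt : ℕ} (hc : 0 < cnt) (i : ℕ)
    (q : Unit → PartyProg α) (a : α) : (sendDigits y cnt i).bind q ≠ .done a := by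
  obtain ⟨c, rfl⟩ := Nat.exists_eq_add_of_le' hc
  rintro ⟨⟩

lemma ghzProtocol_delayed (m : ℕ) : (ghzProtocol m).Delayed where
  leader := by
    intro M s a
    show ghzLeader m M s ≠ _
    match s with
    | .bern .. => rw [ghzLeader_bern]; rintro ⟨⟩
    | .trial .. => rw [ghzLeader_trial]; rintro ⟨⟩
    | .rademacher .. => rw [ghzLeader_rademacher]; rintro ⟨⟩
    | .deal _ _ [] => rw [ghzLeader_deal_nil]; rintro ⟨⟩
    | .deal _ _ (_ :: _) => rw [ghzLeader_deal_cons]; rintro ⟨⟩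
    | .test .. => rw [ghzLeader_test]; rintro ⟨⟩
  party := by
    intro j M s a
    show ghzParty m M s ≠ _
    match s with
    | .bern .. => rw [ghzParty_bern]; exact sendDigits_bind_ne_done _ (batchSize_pos _ _) _ _ _
    | .trial => rw [ghzParty_trial]; rintro ⟨⟩
    | .rademacher .. => rw [ghzParty_rademacher]; rintro ⟨⟩
    | .test .. => rw [ghzParty_test]; exact sendDigits_bind_ne_done _ (batchSize_pos _ _) _ _ _

end Programs

/-! ### Broadcasting to all parties and collecting from all parties -/

namespace Protocol

variable {m : ℕ} {π : Protocol m} {M : Fin (m + 1) → VNMeasurement}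

lemma Delayed.value_broadcast_le (hπ : π.Delayed) (w : Pricing m) (t : ℕ) (b : Bool)
    (k : Unit → LeaderProg m (π.LState ⊕ ℤˣ))
    (q : Fin m → Bool → PartyProg (π.PState ⊕ ℤˣ)) {p : Fin m → PartyProg (π.PState ⊕ ℤˣ)}
    (hp : ∀ j, p j = .recv (q j)) :
    value w M t (⟨(sendAll b (List.finRange m)).bind k, p⟩ : π.Config) ≤
      m * w.bit + value w M t ⟨k (), fun j => q j b⟩ := by
  simpa using hπ.value_sendAll_le w t b (List.finRange m) (List.nodup_finRange m) k q
    (p := p) fun j _ => hp j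

lemma value_collect_le (w : Pricing m) (t : ℕ) {α : Type} (f : Fin m → LeaderProg m α)
    (a : Fin m → α) (c : ℝ≥0∞) (p₀ p₁ : Fin m → PartyProg (π.PState ⊕ ℤˣ))
    (hf : ∀ j (k : α → LeaderProg m (π.LState ⊕ ℤˣ)) p, p j = p₀ j →
      value w M t (⟨(f j).bind k, p⟩ : π.Config) ≤
        c + value w M t ⟨k (a j), Function.update p j (p₁ j)⟩)
    (v : Fin m → α) (k : (Fin m → α) → LeaderProg m (π.LState ⊕ ℤˣ)) :
    value w M t (⟨(forAll f (List.finRange m) v).bind k, p₀⟩ : π.Config) ≤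
      m * c + value w M t ⟨k a, p₁⟩ := by
  simpa using value_forAll_le w t f a c p₀ p₁ hf (List.finRange m) (List.nodup_finRange m) v k
    (p := p₀) fun j _ => rfl

end Protocol

/-! ### Sequential sampling of independent signs -/

section Draw

variable {n : ℕ}

/-- The mean of `f` when the entries of `x` with indices in the list are sampled anew. -/
def drawMean (p : Fin n → ℤˣ → ℝ≥0∞) (f : (Fin n → ℤˣ) → ℝ≥0∞) :
    List (Fin n) → (Fin n → ℤˣ) → ℝ≥0∞
  | [], x => f x
  | j :: js, x => p j 1 * drawMean p f js (Function.update x j 1) +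
      p j (-1) * drawMean p f js (Function.update x j (-1))

/-- The Kronecker factors freeze the entries that are not redrawn, which gives every stage of the
induction on the list the same form. -/
lemma drawMean_eq_sum (p : Fin n → ℤˣ → ℝ≥0∞) (f : (Fin n → ℤˣ) → ℝ≥0∞) (js : List (Fin n))
    (hjs : js.Nodup) (x : Fin n → ℤˣ) :
    drawMean p f js x =
      ∑ z : Fin n → ℤˣ, (∏ j, if j ∈ js then p j (z j) else if z j = x j then 1 else 0) * f z := by
  induction js generalizing x with
  | nil =>
    rw [drawMean, Finset.sum_eq_single x]
    · simp
    · intro z _ hz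
      obtain ⟨j, hj⟩ := Function.ne_iff.1 hz
      rw [Finset.prod_eq_zero (Finset.mem_univ j) (by simp [hj]), zero_mul]
    · simp
  | cons i js ih =>
    rw [List.nodup_cons] at hjs
    rw [drawMean, ih hjs.2, ih hjs.2, Finset.mul_sum, Finset.mul_sum, ← Finset.sum_add_distrib]
    refine Finset.sum_congr rfl fun z _ => ?_
    rw [← mul_assoc, ← mul_assoc, ← add_mul]
    congr 1
    have h : ∀ g : Fin n → ℝ≥0∞, ∏ j, g j = g i * ∏ j ∈ Finset.univ.erase i, g j := fun g =>
      (Finset.mul_prod_erase _ g (Finset.mem_univ i)).symm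
    rw [h, h, h]
    have h' : ∀ s, ∏ j ∈ Finset.univ.erase i, (if j ∈ js then p j (z j) else
        if z j = Function.update x i s j then 1 else 0) =
        ∏ j ∈ Finset.univ.erase i, if j ∈ i :: js then p j (z j) else
          if z j = x j then 1 else 0 := by
      intro s
      refine Finset.prod_congr rfl fun j hj => ?_
      have hj' : j ≠ i := Finset.ne_of_mem_erase hj
      simp [hj']
    rw [h', h']
    simp only [hjs.1, if_false, Function.update_self, List.mem_cons, true_or, if_true]
    rcases Int.units_eq_one_or (z i) with hz | hz <;> simp [hz]

lemma drawMean_finRange (p : Fin n → ℤˣ → ℝ≥0∞) (f : (Fin n → ℤˣ) → ℝ≥0∞) (x : Fin n → ℤˣ) :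
    drawMean p f (List.finRange n) x = ∑ z : Fin n → ℤˣ, (∏ j, p j (z j)) * f z := by
  simp [drawMean_eq_sum p f _ (List.nodup_finRange n)]

end Draw

def flipIf (S : Bool) (s : ℤˣ) : ℤˣ := if S then -s else s

/-- The probability that a tentative sign is `s`, given the global sign `S`. -/
def signProb (M : VNMeasurement) (S : Bool) (s : ℤˣ) : ℝ≥0∞ :=
  ENNReal.ofReal (cosAmp M (flipIf S s) ^ 2)

lemma radParam_mem (M : VNMeasurement) : radParam M ∈ Set.Icc (0 : ℝ) 1 :=
  ⟨sq_nonneg _, Real.cos_sq_le_one _⟩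

lemma mix_radParam (M : VNMeasurement) (S : Bool) (F : ℤˣ → ℝ≥0∞) :
    mix (binTail (radParam M) 0) (F (flipIf S 1)) (F (flipIf S (-1))) =
      signProb M S 1 * F 1 + signProb M S (-1) * F (-1) := by
  have h : 1 - radParam M = cosAmp M (-1) ^ 2 := by
    rw [radParam, M.cosAmp_sq, M.cosAmp_sq]; push_cast; ring
  rw [binTail_zero (radParam_mem M), mix, h, radParam]
  cases S
  · simp [flipIf, signProb]
  · simp [flipIf, signProb, add_comm]

/-- One coin of the comparison of a random number with the digits of `y`. -/
lemma coin_compare_le (y : ℝ) (i : ℕ) (c K A B : ℝ≥0∞) {v : Bool → ℝ≥0∞}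
    (hv : ∀ V, v V ≤ if V = binDigit y (i + 1) then 2 * c + K + mix (binTail y (i + 1)) A B
      else K + if V then B else A) :
    c + (v true + v false) / 2 ≤ 2 * c + K + mix (binTail y i) A B := by
  have h2 : ∀ a : ℝ≥0∞, (2 * a) / 2 = a := fun a => by
    rw [mul_comm, mul_div_assoc, ENNReal.div_self (by simp) (by simp), mul_one]
  -- One of the two coin values ends the comparison, so the expected cost solves e = c + e/2; hence
  -- the factor 2.
  have hs : c + (2 * c + 2 * K) / 2 = 2 * c + K := by
    rw [← mul_add, h2]; ring
  refine (add_le_add le_rfl (ENNReal.div_le_div_right (add_le_add (hv true) (hv false)) 2)).trans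
    (le_of_eq ?_)
  conv_rhs => rw [← mix_binTail y i A B, ← hs]
  simp only [ENNReal.div_eq_inv_mul]
  cases binDigit y (i + 1) <;> simp <;> ring

/-! ### Bounds for the expected prices of the stages -/

section Stages

open Protocol

variable {m : ℕ}

/-- The approximation of `±a₂(x)` in round `k` of the acceptance test. -/
def sinApprox (M : Fin (m + 1) → VNMeasurement) (B : Bool) (x : Fin (m + 1) → ℤˣ) (k : ℕ) : ℝ :=
  (if B then sinAmp (M 0) (x 0) else -sinAmp (M 0) (x 0)) * ∏ j : Fin m,
    decodeSigned (binTrunc (encodeSigned (sinAmp (M j.succ) (x j.succ))) (ampExtra m + k))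

lemma sinApprox_eq (M : Fin (m + 1) → VNMeasurement) (B : Bool) (x : Fin (m + 1) → ℤˣ) (k : ℕ) :
    sinApprox M B x k = if B then ampApprox M x sinAmp k else -ampApprox M x sinAmp k := by
  cases B <;> simp [sinApprox, ampApprox]

/-- The quantity `U L_k - R_k` of the acceptance test. -/
def testDiff (M : Fin (m + 1) → VNMeasurement) (B : Bool) (x : Fin (m + 1) → ℤˣ) (k : ℕ)
    (U : ℝ) : ℝ :=
  U * (ampApprox M x cosAmp k ^ 2 + sinApprox M B x k ^ 2) -
    (ampApprox M x cosAmp k + sinApprox M B x k) ^ 2 / 2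

/-- Each amplitude is known up to 2⁻ᵏ/8, and the test changes by at most 4 times that error. -/
lemma abs_testDiff_sub_le (M : Fin (m + 1) → VNMeasurement) (B : Bool) (x : Fin (m + 1) → ℤˣ)
    (k : ℕ) {U : ℝ} (hU : U ∈ Set.Icc (0 : ℝ) 1) :
    |testDiff M B x k U - (U * envelope M x - branchProb M x B)| ≤ 1 / 2 ^ k / 2 := by
  have hc := fun (M : VNMeasurement) s => M.abs_cosAmp_le_one s
  have hs := fun (M : VNMeasurement) s => M.abs_sinAmp_le_one s
  have h1 : |cosProd M x| ≤ 1 := Finset.abs_prod_le_one _ _ fun j _ => hc _ _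
  have h2 : |sinProd M x| ≤ 1 := Finset.abs_prod_le_one _ _ fun j _ => hs _ _
  have h3 := abs_ampApprox_sub_le M x hs k
  have h4 : (4 : ℝ) * (1 / 2 ^ k / 8) = 1 / 2 ^ k / 2 := by ring
  rw [← h4]
  have h5 : envelope M x =
      cosProd M x ^ 2 + (if B then sinProd M x else -sinProd M x) ^ 2 := by
    cases B <;> simp [envelope]
  rw [h5, testDiff, sinApprox_eq]
  refine abs_test_sub_test_le hU h1 ?_ (abs_ampApprox_le_one M x hc k) ?_
    (abs_ampApprox_sub_le M x hc k) ?_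
  · cases B <;> simpa using h2
  · cases B <;> simpa using abs_ampApprox_le_one M x hs k
  · cases B
    · simp only [Bool.false_eq_true, if_false]
      rw [neg_sub_neg, abs_sub_comm]
      exact h3
    · exact h3

/-- Acceptance in round `k` of the acceptance test, where `U = U(k)`. -/
def testYes (M : Fin (m + 1) → VNMeasurement) (B : Bool) (x : Fin (m + 1) → ℤˣ) (k : ℕ)
    (U : ℝ) : Prop := testDiff M B x k U < -(4 / 2 ^ k)

/-- Rejection in round `k` of the acceptance test, where `U = U(k)`. -/
def testNo (M : Fin (m + 1) → VNMeasurement) (B : Bool) (x : Fin (m + 1) → ℤˣ) (k : ℕ)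
    (U : ℝ) : Prop := testDiff M B x k U > 4 / 2 ^ k

def testGo (M : Fin (m + 1) → VNMeasurement) (B : Bool) (x : Fin (m + 1) → ℤˣ) (k : ℕ)
    (U : ℝ) : Prop := ¬ testYes M B x k U ∧ ¬ testNo M B x k U

/-- The probability that the tentative sample `x` is accepted. -/
def acceptProb (M : Fin (m + 1) → VNMeasurement) (B : Bool) (x : Fin (m + 1) → ℤˣ) : ℝ :=
  branchProb M x B / envelope M x

lemma acceptProb_mem (M : Fin (m + 1) → VNMeasurement) (B : Bool) (x : Fin (m + 1) → ℤˣ) :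
    acceptProb M B x ∈ Set.Icc (0 : ℝ) 1 :=
  ⟨div_nonneg (branchProb_nonneg M x B) (envelope_nonneg M x),
    div_le_one_of_le₀ (branchProb_le_envelope M x B) (envelope_nonneg M x)⟩

/-- This remains true for envelope 0, where the quotient is 0 by convention, since the dominated
branch probability vanishes too. -/
lemma envelope_mul_acceptProb (M : Fin (m + 1) → VNMeasurement) (B : Bool)
    (x : Fin (m + 1) → ℤˣ) : envelope M x * acceptProb M B x = branchProb M x B := by
  rcases eq_or_ne (envelope M x) 0 with h | h
  · have h1 := branchProb_le_envelope M x B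
    have h2 := branchProb_nonneg M x B
    rw [h, zero_mul]; linarith
  · rw [acceptProb, mul_div_cancel₀ _ h]

/-- The margin 4 · 2⁻ᵏ covers the error 2⁻ᵏ/2 and the undetermined digits, which contribute at most
2⁻ᵏ L ≤ 2 · 2⁻ᵏ. -/
lemma testYes.le_acceptProb {M : Fin (m + 1) → VNMeasurement} {B : Bool}
    {x : Fin (m + 1) → ℤˣ} {k : ℕ} {U : ℝ} (h : testYes M B x k U) (h0 : 0 ≤ U)
    (h1 : U + 1 / 2 ^ k ≤ 1) : U + 1 / 2 ^ k ≤ acceptProb M B x := by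
  have h2 : (0 : ℝ) < 1 / 2 ^ k := by positivity
  have h3 := (abs_le.1 (abs_testDiff_sub_le M B x k (U := U) ⟨h0, by linarith⟩)).1
  have hL := envelope_nonneg M x
  have hL2 : envelope M x ≤ 2 := by
    have h4 := Finset.single_le_sum (fun z _ => envelope_nonneg M z) (Finset.mem_univ x)
    rwa [sum_envelope] at h4
  have h5 : testDiff M B x k U < -(4 * (1 / 2 ^ k)) := by
    rw [mul_one_div]; exact h
  have h6 : 1 / 2 ^ k * envelope M x ≤ 1 / 2 ^ k * 2 := by gcongr
  have h7 : (U + 1 / 2 ^ k) * envelope M x < branchProb M x B := by rw [add_mul]; linarith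
  -- A zero envelope would turn the strict inequality into `0 < branchProb`, against the domination.
  have h8 : 0 < envelope M x := by
    refine lt_of_le_of_ne hL fun h0 => ?_
    have h9 := branchProb_le_envelope M x B
    rw [← h0] at h7 h9
    linarith
  rw [acceptProb, le_div_iff₀ h8]
  exact h7.le

lemma testNo.acceptProb_le {M : Fin (m + 1) → VNMeasurement} {B : Bool}
    {x : Fin (m + 1) → ℤˣ} {k : ℕ} {U : ℝ} (h : testNo M B x k U) (h0 : 0 ≤ U)
    (h1 : U ≤ 1) : acceptProb M B x ≤ U := by
  have h2 : (0 : ℝ) < 1 / 2 ^ k := by positivity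
  have h3 := (abs_le.1 (abs_testDiff_sub_le M B x k (U := U) ⟨h0, h1⟩)).2
  have h5 : 4 * (1 / 2 ^ k) < testDiff M B x k U := by
    rw [mul_one_div]; exact h
  refine div_le_of_le_mul₀ (envelope_nonneg M x) h0 ?_
  linarith

/-- The decision `B = 1` in round `k` of the Bernoulli sampler, where `U = U(k)`. -/
def bernYes (M : Fin (m + 1) → VNMeasurement) (k : ℕ) (U : ℝ) : Prop :=
  U ≤ paramApprox M k - 2 / 2 ^ k

/-- The decision `B = 0` in round `k` of the Bernoulli sampler, where `U = U(k)`. -/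
def bernNo (M : Fin (m + 1) → VNMeasurement) (k : ℕ) (U : ℝ) : Prop :=
  U ≥ paramApprox M k + 1 / 2 ^ k

def bernGo (M : Fin (m + 1) → VNMeasurement) (k : ℕ) (U : ℝ) : Prop :=
  ¬ bernYes M k U ∧ ¬ bernNo M k U

/-- One 2⁻ᵏ of the margin pays for the approximation error, the other for the digits not yet tossed.
-/
lemma bernYes.le_branchParam {M : Fin (m + 1) → VNMeasurement} {k : ℕ} {U : ℝ}
    (h : bernYes M k U) : U + 1 / 2 ^ k ≤ branchParam M := by
  have h1 := (abs_le.1 (abs_paramApprox_sub_le M k)).2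
  have h2 : U ≤ paramApprox M k - 2 * (1 / 2 ^ k) := by rw [mul_one_div]; exact h
  linarith

lemma bernNo.branchParam_le {M : Fin (m + 1) → VNMeasurement} {k : ℕ} {U : ℝ}
    (h : bernNo M k U) : branchParam M ≤ U := by
  have h1 := (abs_le.1 (abs_paramApprox_sub_le M k)).1
  have h2 : paramApprox M k + 1 / 2 ^ k ≤ U := h
  linarith

variable (w : Pricing m) (M : Fin (m + 1) → VNMeasurement)

/-- The price of dealing one random digit. -/
def dealCost : ℝ≥0∞ := w.coin + 2 * w.bit

/-- Per party and round: one digit each of c and s, and the bit that says whether to go on. The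
verdict bit is charged in `testValue`, the surplus digits of round 1 in `testSetup`. -/
def testCost : ℝ≥0∞ := w.coin + m * (3 * w.bit)

def bernCost : ℝ≥0∞ := w.coin + m * (2 * w.bit)

def testSetup : ℝ≥0∞ := m * (2 * ampExtra m * w.bit)

def bernSetup : ℝ≥0∞ := m * (angleExtra m * w.bit)

/-- The expected price of a tentative sample, apart from the rounds of the acceptance test. -/
def trialCost : ℝ≥0∞ :=
  w.coin + m * w.bit + 2 * w.coin + 2 * dealCost w * m + w.idle + testSetup w + m * w.bit

/-- The value of the start of the rejection algorithm. -/
def trialValue (B : Bool) : ℝ≥0∞ :=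
  2 * (trialCost w + ∑ x, ENNReal.ofReal (envelope M x / 2) *
    (testCost w * loopRounds (testGo M B x) 1 0 + ENNReal.ofReal (acceptProb M B x) * w.reward x))

def testValue (B : Bool) (x : Fin (m + 1) → ℤˣ) (k : ℕ) (U : ℝ) : ℝ≥0∞ :=
  loopValue (testGo M B x) (acceptProb M B x) (testCost w) (m * w.bit + w.reward x)
    (m * w.bit + trialValue w M B) k U + if k = 1 then testSetup w else 0

def bernValue (k : ℕ) (U : ℝ) : ℝ≥0∞ :=
  loopValue (bernGo M) (branchParam M) (bernCost w) (trialValue w M true) (trialValue w M false)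
    k U + if k = 1 then bernSetup w else 0

/-- The mean value of the acceptance test when the signs in the list are still to be sampled. -/
def testMean (B S : Bool) (js : List (Fin m)) (x : Fin (m + 1) → ℤˣ) : ℝ≥0∞ :=
  drawMean (fun j => signProb (M j) S) (fun x => w.idle + testValue w M B x 1 0)
    (js.map Fin.succ) x

/-- `i` coins have already agreed with the digits of the party at the head, so its sign is governed
by the tail after `i` digits; the later parties have not begun. -/
def dealValue (B S : Bool) : List (Fin m) → (Fin (m + 1) → ℤˣ) → ℕ → ℝ≥0∞
  | [], x, _ => w.idle + testValue w M B x 1 0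
  | j :: js, x, i => 2 * dealCost w + 2 * dealCost w * js.length +
      mix (binTail (radParam (M j.succ)) i)
        (testMean w M B S js (Function.update x j.succ (flipIf S 1)))
        (testMean w M B S js (Function.update x j.succ (flipIf S (-1))))

lemma dealValue_zero (B S : Bool) (js : List (Fin m)) (x : Fin (m + 1) → ℤˣ) :
    dealValue w M B S js x 0 = 2 * dealCost w * js.length + testMean w M B S js x := by
  cases js with
  | nil => simp [dealValue, testMean, drawMean]
  | cons j js =>
    rw [dealValue, mix_radParam (M j.succ) S
      fun s => testMean w M B S js (Function.update x j.succ s)]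
    have h : testMean w M B S (j :: js) x =
        signProb (M j.succ) S 1 * testMean w M B S js (Function.update x j.succ 1) +
        signProb (M j.succ) S (-1) * testMean w M B S js (Function.update x j.succ (-1)) := rfl
    rw [h, List.length_cons]
    push_cast
    ring

/-- The constant tuple 1 is a placeholder: every entry is overwritten before the test. -/
def rademacherValue (B S : Bool) (i : ℕ) : ℝ≥0∞ :=
  2 * w.coin + 2 * dealCost w * m +
    mix (binTail (radParam (M 0)) i)
      (testMean w M B S (List.finRange m) (Function.update 1 0 (flipIf S 1)))
      (testMean w M B S (List.finRange m) (Function.update 1 0 (flipIf S (-1))))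

/-- Parties outside the list already have their sign and wait at the first round of the test. -/
def dealStates (S : Bool) : List (Fin m) → (Fin (m + 1) → ℤˣ) → ℕ → Fin m → GHZPartyState
  | [], x, _, j => .test (x j.succ) 1
  | j' :: js, x, i, j => if j = j' then .rademacher S (i + 1) else
      if j ∈ js then .rademacher S 1 else .test (x j.succ) 1

lemma dealStates_cons_self (S : Bool) (js : List (Fin m)) (x : Fin (m + 1) → ℤˣ) (i : ℕ)
    (j : Fin m) : dealStates S (j :: js) x i j = .rademacher S (i + 1) := if_pos rfl

lemma dealStates_cons_of_ne (S : Bool) (js : List (Fin m)) (x : Fin (m + 1) → ℤˣ) (i : ℕ)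
    {j j' : Fin m} (h : j ≠ j') : dealStates S (j' :: js) x i j =
      if j ∈ js then .rademacher S 1 else .test (x j.succ) 1 := if_neg h

lemma dealStates_zero (S : Bool) (js : List (Fin m)) (x : Fin (m + 1) → ℤˣ) (j : Fin m) :
    dealStates S js x 0 j = if j ∈ js then .rademacher S 1 else .test (x j.succ) 1 := by
  cases js with
  | nil => simp [dealStates]
  | cons j' js =>
    rcases eq_or_ne j j' with rfl | h <;> simp [dealStates, *]

abbrev ghzConfig (s : GHZLeaderState m) (σ : Fin m → GHZPartyState) : (ghzProtocol m).Config :=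
  (ghzProtocol m).atStates s σ

/-- The bounds for the values after at most `t` further steps. -/
structure StageBounds (t : ℕ) : Prop where
  -- The conditions on `U` say that the interval [U, U + 2^(1-k)] of still possible random numbers
  -- lies in [0, 1].
  bern : ∀ k U, 1 ≤ k → 0 ≤ U → U + 2 / 2 ^ k ≤ 1 →
    value w M t (ghzConfig
      (.bern k U fun j => truncBefore (encodeAngle (M j.succ).θ) (angleExtra m) k)
      fun _ => .bern k) ≤ bernValue w M k U
  trial : ∀ B, value w M t (ghzConfig (.trial B) fun _ => .trial) ≤ trialValue w M B
  rademacher : ∀ B S i,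
    value w M t (ghzConfig (.rademacher B S (i + 1)) fun _ => .rademacher S 1) ≤
      rademacherValue w M B S i
  deal : ∀ B S js x i, js.Nodup →
    value w M t (ghzConfig (.deal B (x 0) js) (dealStates S js x i)) ≤ dealValue w M B S js x i
  test : ∀ B x k U, 1 ≤ k → 0 ≤ U → U + 2 / 2 ^ k ≤ 1 →
    value w M t (ghzConfig
      (.test B (x 0) k U fun j =>
        (truncBefore (encodeSigned (cosAmp (M j.succ) (x j.succ))) (ampExtra m) k,
         truncBefore (encodeSigned (sinAmp (M j.succ) (x j.succ))) (ampExtra m) k))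
      fun j => .test (x j.succ) k) ≤ testValue w M B x k U

end Stages

namespace Protocol

variable {m : ℕ} {π : Protocol m} {M : Fin (m + 1) → VNMeasurement} {w : Pricing m} {t : ℕ}

lemma Delayed.value_atStates_toss_le (hπ : π.Delayed) {s : π.LState}
    {σ : Fin m → π.PState} {k : Bool → LeaderProg m (π.LState ⊕ ℤˣ)}
    (hs : π.leader (M 0) s = .toss k) (v : Bool → ℝ≥0∞)
    (hv : ∀ b, value w M t (⟨k b, fun j => π.party j (M j.succ) (σ j)⟩ : π.Config) ≤ v b) :
    value w M (t + 1) (π.atStates s σ) ≤ w.coin + (v true + v false) / 2 := by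
  rw [hπ.value_atStates_toss w t s σ hs]
  exact add_le_add le_rfl (ENNReal.div_le_div_right (add_le_add (hv _) (hv _)) 2)

lemma value_ite_pos {c : Prop} [Decidable c] (hc : c) {l l' : LeaderProg m (π.LState ⊕ ℤˣ)}
    {p : Fin m → PartyProg (π.PState ⊕ ℤˣ)} {v : ℝ≥0∞}
    (hv : value w M t (⟨l, p⟩ : π.Config) ≤ v) :
    value w M t (⟨if c then l else l', p⟩ : π.Config) ≤ v := by
  rwa [if_pos hc]

lemma value_ite_neg {c : Prop} [Decidable c] (hc : ¬ c) {l l' : LeaderProg m (π.LState ⊕ ℤˣ)}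
    {p : Fin m → PartyProg (π.PState ⊕ ℤˣ)} {v : ℝ≥0∞}
    (hv : value w M t (⟨l', p⟩ : π.Config) ≤ v) :
    value w M t (⟨if c then l else l', p⟩ : π.Config) ≤ v := by
  rwa [if_neg hc]

end Protocol

/-! ### One-step inequalities for the loops and the digit comparisons -/

section Stages

open Protocol

variable {m : ℕ} {w : Pricing m} {M : Fin (m + 1) → VNMeasurement} {t : ℕ}

lemma value_ghzConfig_toss_le {s : GHZLeaderState m} {σ : Fin m → GHZPartyState}
    {k : Bool → LeaderProg m (GHZLeaderState m ⊕ ℤˣ)} (hs : ghzLeader m (M 0) s = .toss k)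
    (v : Bool → ℝ≥0∞)
    (hv : ∀ b, value w M t
      (⟨k b, fun j => ghzParty m (M j.succ) (σ j)⟩ : (ghzProtocol m).Config) ≤ v b) :
    value w M (t + 1) (ghzConfig s σ) ≤ w.coin + (v true + v false) / 2 :=
  (ghzProtocol_delayed m).value_atStates_toss_le hs v hv

lemma batchSize_mul (first k : ℕ) (c : ℝ≥0∞) :
    (batchSize first k : ℝ≥0∞) * c = c + if k = 1 then first * c else 0 := by
  unfold batchSize
  split_ifs
  · push_cast; ring
  · simp

lemma bit_div_mem {k : ℕ} {U : ℝ} (h0 : 0 ≤ U) (h1 : U + 2 / 2 ^ k ≤ 1) (b : Bool) :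
    0 ≤ U + bitVal b / 2 ^ k ∧ U + bitVal b / 2 ^ k + 1 / 2 ^ k ≤ 1 := by
  have h2 : (0 : ℝ) < 1 / 2 ^ k := by positivity
  have h3 : U + 2 * (1 / 2 ^ k) ≤ 1 := by rwa [mul_one_div]
  cases b
  · simp only [bitVal, Bool.false_eq_true, if_false, zero_div, add_zero]
    exact ⟨h0, by linarith⟩
  · simp only [bitVal, if_true]
    exact ⟨by linarith, by linarith⟩

lemma two_div_two_pow_succ (k : ℕ) : (2 : ℝ) / 2 ^ (k + 1) = 1 / 2 ^ k := by
  rw [pow_succ]; field_simp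

lemma ENNReal.add_half_add (a b c d : ℝ≥0∞) :
    a + ((b + c) + (b + d)) / 2 = b + (a + (c + d) / 2) := by
  have h2 : (2 * b) / 2 = b := by
    rw [mul_comm, mul_div_assoc, ENNReal.div_self (by simp) (by simp), mul_one]
  conv_rhs => rw [← h2]
  simp only [ENNReal.div_eq_inv_mul]
  ring

lemma StageBounds.bern_succ (h : StageBounds w M t) (k : ℕ) (U : ℝ) (hk : 1 ≤ k) (h0 : 0 ≤ U)
    (h1 : U + 2 / 2 ^ k ≤ 1) :
    value w M (t + 1) (ghzConfig
      (.bern k U fun j => truncBefore (encodeAngle (M j.succ).θ) (angleExtra m) k)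
      fun _ => .bern k) ≤ bernValue w M k U := by
  classical
  have hπ := ghzProtocol_delayed m
  -- The bits of the round do not depend on its coin; they are split off so that `loopValue_step`
  -- applies to the rest.
  set K : ℝ≥0∞ := m * (batchSize (angleExtra m) k * w.bit) + m * w.bit with hK
  set v : Bool → ℝ≥0∞ := fun b =>
    if bernYes M k (U + bitVal b / 2 ^ k) then trialValue w M true else
      if bernNo M k (U + bitVal b / 2 ^ k) then trialValue w M false else
      loopValue (bernGo M) (branchParam M) (bernCost w) (trialValue w M true)
        (trialValue w M false) (k + 1) (U + bitVal b / 2 ^ k) with hv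
  have hstep : value w M (t + 1) (ghzConfig
      (.bern k U fun j => truncBefore (encodeAngle (M j.succ).θ) (angleExtra m) k)
      fun _ => .bern k) ≤ w.coin + ((K + v true) + (K + v false)) / 2 := by
    refine value_ghzConfig_toss_le (ghzLeader_bern (M 0) k U _) (fun b => K + v b) fun b => ?_
    refine (value_collect_le w t _
      (fun j => binTrunc (encodeAngle (M j.succ).θ) (angleExtra m + k))
      (batchSize (angleExtra m) k * w.bit) _
      (fun _ => .recv fun more =>
        .done (.inl (if more then GHZPartyState.bern (k + 1) else GHZPartyState.trial)))
      ?_ _ _).trans ?_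
    · intro j k' p hp
      rw [← truncBefore_add_digitSum _ _ _ hk]
      exact hπ.value_recvDigits_le w t j _ _ _ _ k' _ hp
    · rw [hK, add_assoc]
      refine add_le_add le_rfl ?_
      by_cases hy : bernYes M k (U + bitVal b / 2 ^ k)
      · refine value_ite_pos hy ((hπ.value_broadcast_le w t _ _ _ fun j => rfl).trans ?_)
        refine add_le_add le_rfl ?_
        simp only [hv, if_pos hy]
        exact h.trial true
      · refine value_ite_neg hy ?_
        by_cases hn : bernNo M k (U + bitVal b / 2 ^ k)
        · refine value_ite_pos hn ((hπ.value_broadcast_le w t _ _ _ fun j => rfl).trans ?_)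
          refine add_le_add le_rfl ?_
          simp only [hv, if_neg hy, if_pos hn]
          exact h.trial false
        · refine value_ite_neg hn ((hπ.value_broadcast_le w t _ _ _ fun j => rfl).trans ?_)
          refine add_le_add le_rfl ?_
          simp only [hv, if_neg hy, if_neg hn]
          obtain ⟨h2, h3⟩ := bit_div_mem h0 h1 b
          have h4 := h.bern (k + 1) (U + bitVal b / 2 ^ k) (by omega) h2
            (by rw [two_div_two_pow_succ]; exact h3)
          simp only [truncBefore_succ _ _ _ hk] at h4
          refine h4.trans (le_of_eq ?_)
          rw [bernValue, if_neg (by omega), add_zero]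
  refine hstep.trans ?_
  rw [ENNReal.add_half_add]
  have hloop := loopValue_step (bernYes M) (bernNo M) (branchParam M) (bernCost w)
    (trialValue w M true) (trialValue w M false) k U (fun b hb => hb.le_branchParam)
    (fun b hb => hb.branchParam_le) (v := v) (fun b => le_rfl)
  -- The surplus digits of round 1 are exactly the setup price.
  have hK' : K + (w.coin + (v true + v false) / 2) =
      bernCost w + (v true + v false) / 2 + if k = 1 then bernSetup w else 0 := by
    rw [hK, batchSize_mul, bernCost, bernSetup]
    split_ifs <;> ring
  rw [hK']
  exact add_le_add hloop le_rfl

lemma StageBounds.test_succ (h : StageBounds w M t) (B : Bool) (x : Fin (m + 1) → ℤˣ) (k : ℕ)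
    (U : ℝ) (hk : 1 ≤ k) (h0 : 0 ≤ U) (h1 : U + 2 / 2 ^ k ≤ 1) :
    value w M (t + 1) (ghzConfig
      (.test B (x 0) k U fun j =>
        (truncBefore (encodeSigned (cosAmp (M j.succ) (x j.succ))) (ampExtra m) k,
         truncBefore (encodeSigned (sinAmp (M j.succ) (x j.succ))) (ampExtra m) k))
      fun j => .test (x j.succ) k) ≤ testValue w M B x k U := by
  classical
  have hπ := ghzProtocol_delayed m
  set K : ℝ≥0∞ := m * (batchSize (ampExtra m) k * w.bit + batchSize (ampExtra m) k * w.bit) +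
    m * w.bit with hK
  set v : Bool → ℝ≥0∞ := fun b =>
    if testYes M B x k (U + bitVal b / 2 ^ k) then m * w.bit + w.reward x else
      if testNo M B x k (U + bitVal b / 2 ^ k) then m * w.bit + trialValue w M B else
      loopValue (testGo M B x) (acceptProb M B x) (testCost w) (m * w.bit + w.reward x)
        (m * w.bit + trialValue w M B) (k + 1) (U + bitVal b / 2 ^ k) with hv
  have hstep : value w M (t + 1) (ghzConfig
      (.test B (x 0) k U fun j =>
        (truncBefore (encodeSigned (cosAmp (M j.succ) (x j.succ))) (ampExtra m) k,
         truncBefore (encodeSigned (sinAmp (M j.succ) (x j.succ))) (ampExtra m) k))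
      fun j => .test (x j.succ) k) ≤ w.coin + ((K + v true) + (K + v false)) / 2 := by
    refine value_ghzConfig_toss_le (ghzLeader_test (M 0) B (x 0) k U _) (fun b => K + v b)
      fun b => ?_
    refine (value_collect_le w t _
      (fun j => (binTrunc (encodeSigned (cosAmp (M j.succ) (x j.succ))) (ampExtra m + k),
        binTrunc (encodeSigned (sinAmp (M j.succ) (x j.succ))) (ampExtra m + k)))
      (batchSize (ampExtra m) k * w.bit + batchSize (ampExtra m) k * w.bit) _
      (fun j => .recv fun more => if more = true then
          .done (.inl (GHZPartyState.test (x j.succ) (k + 1)))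
        else .recv fun accepted =>
          .done (if accepted = true then .inr (x j.succ) else .inl GHZPartyState.trial))
      ?_ _ _).trans ?_
    · intro j k' p hp
      simp only [LeaderProg.bind_assoc, LeaderProg.bind]
      rw [← truncBefore_add_digitSum _ _ _ hk, ← truncBefore_add_digitSum _ _ _ hk]
      exact hπ.value_recvDigits_two_le w t j _ _ _ _ _ _ (fun c s => k' (c, s)) _ hp
    · rw [hK, add_assoc]
      refine add_le_add le_rfl ?_
      by_cases hy : testYes M B x k (U + bitVal b / 2 ^ k)
      · refine value_ite_pos hy ((hπ.value_broadcast_le w t _ _ _ fun j => rfl).trans ?_)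
        refine add_le_add le_rfl ?_
        -- Every party has learnt that the test is over and now waits for the verdict.
        refine (hπ.value_broadcast_le w t _ _ (fun j accepted =>
          .done (if accepted = true then .inr (x j.succ) else .inl GHZPartyState.trial))
          fun j => rfl).trans ?_
        simp only [hv, if_pos hy]
        refine add_le_add le_rfl (le_of_eq ?_)
        -- All parties have halted: no further price is due and the reward is collected.
        exact value_of_outputs w t ⟨rfl, fun j => rfl⟩
      · refine value_ite_neg hy ?_
        by_cases hn : testNo M B x k (U + bitVal b / 2 ^ k)
        · refine value_ite_pos hn ((hπ.value_broadcast_le w t _ _ _ fun j => rfl).trans ?_)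
          refine add_le_add le_rfl ?_
          refine (hπ.value_broadcast_le w t _ _ (fun j accepted =>
            .done (if accepted = true then .inr (x j.succ) else .inl GHZPartyState.trial))
            fun j => rfl).trans ?_
          simp only [hv, if_neg hy, if_pos hn]
          exact add_le_add le_rfl (h.trial B)
        · refine value_ite_neg hn ((hπ.value_broadcast_le w t _ _ _ fun j => rfl).trans ?_)
          refine add_le_add le_rfl ?_
          simp only [hv, if_neg hy, if_neg hn]
          obtain ⟨h2, h3⟩ := bit_div_mem h0 h1 b
          have h4 := h.test B x (k + 1) (U + bitVal b / 2 ^ k) (by omega) h2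
            (by rw [two_div_two_pow_succ]; exact h3)
          simp only [truncBefore_succ _ _ _ hk] at h4
          refine h4.trans (le_of_eq ?_)
          rw [testValue, if_neg (by omega), add_zero]
  refine hstep.trans ?_
  rw [ENNReal.add_half_add]
  have hloop := loopValue_step (testYes M B x) (testNo M B x) (acceptProb M B x) (testCost w)
    (m * w.bit + w.reward x) (m * w.bit + trialValue w M B) k U
    (fun b hb => hb.le_acceptProb (bit_div_mem h0 h1 b).1 (bit_div_mem h0 h1 b).2)
    (fun b hb => hb.acceptProb_le (bit_div_mem h0 h1 b).1
      (by linarith [(bit_div_mem h0 h1 b).2, show (0 : ℝ) < 1 / 2 ^ k by positivity]))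
    (v := v) (fun b => le_rfl)
  have hK' : K + (w.coin + (v true + v false) / 2) =
      testCost w + (v true + v false) / 2 + if k = 1 then testSetup w else 0 := by
    rw [hK, batchSize_mul, testCost, testSetup]
    split_ifs <;> ring
  rw [hK']
  exact add_le_add hloop le_rfl

lemma StageBounds.rademacher_succ (h : StageBounds w M t) (B S : Bool) (i : ℕ) :
    value w M (t + 1) (ghzConfig (.rademacher B S (i + 1)) fun _ => .rademacher S 1) ≤
      rademacherValue w M B S i := by
  have hπ := ghzProtocol_delayed m
  set v : Bool → ℝ≥0∞ := fun V =>
      if V = binDigit (radParam (M 0)) (i + 1) then rademacherValue w M B S (i + 1)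
      else 2 * dealCost w * m + if V then
        testMean w M B S (List.finRange m) (Function.update 1 0 (flipIf S (-1)))
        else testMean w M B S (List.finRange m) (Function.update 1 0 (flipIf S 1)) with hv
  refine (value_ghzConfig_toss_le (ghzLeader_rademacher (M 0) B S (i + 1)) v fun V => ?_).trans
    (coin_compare_le (radParam (M 0)) i w.coin _ _ _ (v := v) fun V => le_rfl)
  simp only [hv]
  by_cases hV : V = binDigit (radParam (M 0)) (i + 1)
  · rw [if_pos hV, if_pos hV]
    refine (le_of_eq ?_).trans (h.rademacher B S (i + 1))
    exact hπ.value_congr w t _ fun j => hπ.resume_resume j (.done (.inl (.rademacher S 1)))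
  · rw [if_neg hV, if_neg hV]
    set X : ℤˣ := if V then -1 else 1 with hX
    have h1 := h.deal B S (List.finRange m) (Function.update 1 0 (flipIf S X)) 0
      (List.nodup_finRange m)
    rw [dealValue_zero, Function.update_self, List.length_finRange] at h1
    have h2 : (if V = true then
          testMean w M B S (List.finRange m) (Function.update 1 0 (flipIf S (-1)))
        else testMean w M B S (List.finRange m) (Function.update 1 0 (flipIf S 1))) =
        testMean w M B S (List.finRange m) (Function.update 1 0 (flipIf S X)) := by
      cases V <;> rfl
    rw [h2]
    refine (le_of_eq ?_).trans h1
    refine hπ.value_congr w t _ fun j => ?_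
    refine (hπ.resume_resume j (.done (.inl (.rademacher S 1)))).trans ?_
    rw [dealStates_zero, if_pos (List.mem_finRange j)]

lemma StageBounds.deal_succ (h : StageBounds w M t) (B S : Bool) (js : List (Fin m))
    (x : Fin (m + 1) → ℤˣ) (i : ℕ) (hjs : js.Nodup) :
    value w M (t + 1) (ghzConfig (.deal B (x 0) js) (dealStates S js x i)) ≤
      dealValue w M B S js x i := by
  have hπ := ghzProtocol_delayed m
  cases js with
  | nil =>
    -- The leader only changes its state; this is the single idle step of a trial.
    refine (hπ.value_atStates_idle (M := M) w t
      (GHZLeaderState.deal B (x 0) []) (GHZLeaderState.test B (x 0) 1 0 fun _ => (0, 0)) _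
      (ghzLeader_deal_nil (M 0) B (x 0))).trans ?_
    -- `truncBefore` is 0 in round 1, in agreement with the leader's initial pair `(0, 0)`.
    exact add_le_add le_rfl (h.test B x 1 0 le_rfl le_rfl (by norm_num))
  | cons j js =>
    have hjs' := List.nodup_cons.1 hjs
    set d := binDigit (radParam (M j.succ)) (i + 1) with hd
    have hexec : ∀ V, value w M t (⟨.send j V (.recv j fun more =>
        .done (.inl (GHZLeaderState.deal B (x 0) (if more then j :: js else js)))),
          fun l => ghzParty m (M l.succ) (dealStates S (j :: js) x i l)⟩ :
        (ghzProtocol m).Config) ≤ 2 * w.bit + value w M t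
        (⟨.done (.inl (GHZLeaderState.deal B (x 0) (if (V == d) = true then j :: js else js))),
          Function.update (fun l => ghzParty m (M l.succ) (dealStates S (j :: js) x i l)) j
          (if (V == d) = true then .done (.inl (.rademacher S (i + 1 + 1)))
            else .done (.inl (.test (flipIf S (if V then -1 else 1)) 1)))⟩ :
        (ghzProtocol m).Config) := by
      intro V
      have hj : ghzParty m (M j.succ) (dealStates S (j :: js) x i j) =
          ghzParty m (M j.succ) (.rademacher S (i + 1)) := by
        rw [dealStates_cons_self]
      exact hπ.value_send_recv_le w t j V _ (fun V => V == d)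
        (fun V => if (V == d) = true then .done (.inl (.rademacher S (i + 1 + 1)))
            else .done (.inl (.test (flipIf S (if V then -1 else 1)) 1))) hj
    set v : Bool → ℝ≥0∞ := fun V => if V = d then dealValue w M B S (j :: js) x (i + 1)
      else 2 * dealCost w * js.length + if V then
        testMean w M B S js (Function.update x j.succ (flipIf S (-1)))
        else testMean w M B S js (Function.update x j.succ (flipIf S 1)) with hv
    refine (value_ghzConfig_toss_le (ghzLeader_deal_cons (M 0) B (x 0) j js)
      (fun V => 2 * w.bit + v V) fun V => (hexec V).trans (add_le_add le_rfl ?_)).trans (by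
        rw [ENNReal.add_half_add, ← add_assoc, add_comm (2 * w.bit), ← dealCost, dealValue]
        exact coin_compare_le (radParam (M j.succ)) i (dealCost w) _ _ _ (v := v) fun V => le_rfl)
    simp only [hv]
    by_cases hV : V = d
    · have hV' : (V == d) = true := by simpa using hV
      rw [if_pos hV, if_pos hV', if_pos hV']
      refine (le_of_eq ?_).trans (h.deal B S (j :: js) x (i + 1) hjs)
      refine hπ.value_update_state w t _ (dealStates S (j :: js) x i)
        (dealStates S (j :: js) x (i + 1)) j _ ?_ fun l hl => ?_
      · exact dealStates_cons_self ..
      · exact (dealStates_cons_of_ne _ _ _ _ hl).trans (dealStates_cons_of_ne _ _ _ _ hl).symm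
    · have hV' : ¬ (V == d) = true := by simpa using hV
      rw [if_neg hV, if_neg hV', if_neg hV']
      set X : ℤˣ := if V then -1 else 1 with hX
      have h1 := h.deal B S js (Function.update x j.succ (flipIf S X)) 0 hjs'.2
      rw [dealValue_zero, Function.update_of_ne (Fin.succ_ne_zero j).symm] at h1
      have h2 : (if V = true then testMean w M B S js (Function.update x j.succ (flipIf S (-1)))
          else testMean w M B S js (Function.update x j.succ (flipIf S 1))) =
          testMean w M B S js (Function.update x j.succ (flipIf S X)) := by
        cases V <;> rfl
      rw [h2]
      refine (le_of_eq ?_).trans h1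
      refine hπ.value_update_state w t _ (dealStates S (j :: js) x i) (dealStates S js _ 0) j _ ?_
        fun l hl => ?_
      · exact (dealStates_zero ..).trans (by rw [if_neg hjs'.1, Function.update_self])
      · refine (dealStates_zero ..).trans ?_
        rw [Function.update_of_ne fun hh => hl (Fin.succ_injective _ hh)]
        exact (dealStates_cons_of_ne _ _ _ _ hl).symm

end Stages

/-! ### The renewal equation of the rejection algorithm -/

section Stages

open Protocol

variable {m : ℕ} {w : Pricing m} {M : Fin (m + 1) → VNMeasurement} {t : ℕ}

/-- Negating all signs turns ∏ c_j² into ∏ s_j², and `S` averages the two product laws. -/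
lemma prod_signProb_average (x : Fin (m + 1) → ℤˣ) :
    (∏ j, signProb (M j) true (x j) + ∏ j, signProb (M j) false (x j)) / 2 =
      ENNReal.ofReal (envelope M x / 2) := by
  have h1 : ∏ j, signProb (M j) true (x j) = ENNReal.ofReal (sinProd M x ^ 2) := by
    simp only [signProb, flipIf, if_true, VNMeasurement.cosAmp_neg_sq]
    rw [← ENNReal.ofReal_prod_of_nonneg fun _ _ => sq_nonneg _, Finset.prod_pow, sinProd]
  have h2 : ∏ j, signProb (M j) false (x j) = ENNReal.ofReal (cosProd M x ^ 2) := by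
    simp only [signProb, flipIf]
    rw [← ENNReal.ofReal_prod_of_nonneg fun _ _ => sq_nonneg _, Finset.prod_pow, cosProd]
    simp
  rw [h1, h2, ← ENNReal.ofReal_add (sq_nonneg _) (sq_nonneg _), envelope, add_comm,
    ENNReal.ofReal_div_of_pos two_pos]
  simp

lemma sum_ofReal_envelope (M : Fin (m + 1) → VNMeasurement) :
    ∑ x, ENNReal.ofReal (envelope M x / 2) = 1 := by
  rw [← ENNReal.ofReal_sum_of_nonneg fun x _ => by linarith [envelope_nonneg M x],
    ← Finset.sum_div, sum_envelope]
  simp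

lemma ofReal_envelope_mul_acceptProb (B : Bool) (x : Fin (m + 1) → ℤˣ) :
    ENNReal.ofReal (envelope M x / 2) * ENNReal.ofReal (acceptProb M B x) =
      ENNReal.ofReal (branchProb M x B / 2) := by
  rw [← ENNReal.ofReal_mul (by linarith [envelope_nonneg M x]), div_mul_eq_mul_div,
    envelope_mul_acceptProb]

/-- The branch probability has mass 1 and the envelope mass 2, so half of the tentative samples are
rejected. -/
lemma sum_ofReal_envelope_mul_reject (M : Fin (m + 1) → VNMeasurement) (B : Bool) :
    ∑ x, ENNReal.ofReal (envelope M x / 2) * ENNReal.ofReal (1 - acceptProb M B x) = 2⁻¹ := by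
  have h : ∀ x, ENNReal.ofReal (envelope M x / 2) * ENNReal.ofReal (1 - acceptProb M B x) =
      ENNReal.ofReal (envelope M x / 2 - branchProb M x B / 2) := by
    intro x
    rw [← ENNReal.ofReal_mul (by linarith [envelope_nonneg M x]), mul_sub, mul_one,
      div_mul_eq_mul_div, envelope_mul_acceptProb]
  simp only [h]
  rw [← ENNReal.ofReal_sum_of_nonneg fun x _ => by linarith [branchProb_le_envelope M x B],
    Finset.sum_sub_distrib, ← Finset.sum_div, ← Finset.sum_div, sum_envelope,
    sum_branchProb M (Nat.succ_ne_zero m), show (2 : ℝ) / 2 - 1 / 2 = 2⁻¹ by norm_num,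
    ENNReal.ofReal_inv_of_pos two_pos, ENNReal.ofReal_ofNat]

lemma rademacherValue_zero (B S : Bool) :
    rademacherValue w M B S 0 = 2 * w.coin + 2 * dealCost w * m +
      ∑ x : Fin (m + 1) → ℤˣ,
        (∏ j, signProb (M j) S (x j)) * (w.idle + testValue w M B x 1 0) := by
  rw [rademacherValue, mix_radParam (M 0) S
    fun s => testMean w M B S (List.finRange m) (Function.update 1 0 s),
    ← drawMean_finRange (fun j => signProb (M j) S) _ 1, List.finRange_succ]
  rfl

/-- After a rejection, of probability 1/2, everything starts afresh. The value therefore solves T =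
E + T/2, which explains the factor 2 in `trialValue`. -/
lemma trialValue_eq (w : Pricing m) (M : Fin (m + 1) → VNMeasurement) (B : Bool) :
    trialValue w M B = w.coin + m * w.bit + (2 * w.coin + 2 * dealCost w * m) +
      ∑ x : Fin (m + 1) → ℤˣ,
        ENNReal.ofReal (envelope M x / 2) * (w.idle + testValue w M B x 1 0) := by
  have h : ∀ x, w.idle + testValue w M B x 1 0 = w.idle + testSetup w + m * w.bit +
      (testCost w * loopRounds (testGo M B x) 1 0 +
        ENNReal.ofReal (acceptProb M B x) * w.reward x) +
      ENNReal.ofReal (1 - acceptProb M B x) * trialValue w M B := by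
    intro x
    rw [testValue, loopValue, below_start (acceptProb_mem M B x),
      ← add_mix (acceptProb_mem M B x), mix, if_pos rfl]
    ring
  simp only [h, mul_add _ (_ + _) (_ * trialValue w M B), Finset.sum_add_distrib,
    ← mul_assoc _ _ (trialValue w M B), ← Finset.sum_mul, sum_ofReal_envelope_mul_reject]
  simp only [mul_add _ (w.idle + _ + _) (_ + _), Finset.sum_add_distrib, ← Finset.sum_mul,
    sum_ofReal_envelope, one_mul]
  set Q := ∑ x, ENNReal.ofReal (envelope M x / 2) * (testCost w * loopRounds (testGo M B x) 1 0 +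
        ENNReal.ofReal (acceptProb M B x) * w.reward x) with hQ
  have hT : trialValue w M B = 2 * (trialCost w + Q) := rfl
  -- The solution is substituted rather than derived by subtraction, so infinite values need no
  -- separate treatment.
  have hT2 : 2⁻¹ * trialValue w M B = trialCost w + Q := by
    rw [hT, ← mul_assoc, ENNReal.inv_mul_cancel (by simp) (by simp), one_mul]
  rw [hT2, hT, trialCost]
  ring

lemma StageBounds.trial_succ (h : StageBounds w M t) (B : Bool) :
    value w M (t + 1) (ghzConfig (.trial B) fun _ => .trial) ≤ trialValue w M B := by
  have hπ := ghzProtocol_delayed m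
  refine (value_ghzConfig_toss_le (ghzLeader_trial (M 0) B)
    (fun S => m * w.bit + rademacherValue w M B S 0) fun S => ?_).trans (le_of_eq ?_)
  · refine (hπ.value_broadcast_le w t _ _ (fun j S => .done (.inl (GHZPartyState.rademacher S 1)))
      fun j => rfl).trans ?_
    exact add_le_add le_rfl (h.rademacher B S 0)
  · rw [ENNReal.add_half_add, trialValue_eq, rademacherValue_zero, rademacherValue_zero,
      ENNReal.add_half_add]
    have hsum : ∑ x : Fin (m + 1) → ℤˣ,
        ENNReal.ofReal (envelope M x / 2) * (w.idle + testValue w M B x 1 0) =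
        (∑ x : Fin (m + 1) → ℤˣ,
          (∏ j, signProb (M j) true (x j)) * (w.idle + testValue w M B x 1 0) +
        ∑ x : Fin (m + 1) → ℤˣ,
          (∏ j, signProb (M j) false (x j)) * (w.idle + testValue w M B x 1 0)) / 2 := by
      rw [← Finset.sum_add_distrib, ENNReal.div_eq_inv_mul, Finset.mul_sum]
      refine Finset.sum_congr rfl fun x _ => ?_
      rw [← prod_signProb_average, ← add_mul, ← mul_assoc, ENNReal.div_eq_inv_mul]
    rw [hsum]
    ring

/-- With no step left, no stage has produced an output and all values are 0. Afterwards each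
potential reproduces itself under one step. -/
lemma stageBounds (w : Pricing m) (M : Fin (m + 1) → VNMeasurement) (t : ℕ) :
    StageBounds w M t := by
  induction t with
  | zero =>
    have h : ∀ s σ, value w M 0 (ghzConfig s σ) = 0 := fun s σ => value_zero_atStates w _ _
    constructor <;> intros <;> rw [h] <;> exact zero_le
  | succ t ih =>
    exact ⟨ih.bern_succ, ih.trial_succ, ih.rademacher_succ, ih.deal_succ, ih.test_succ⟩

/-- The bound for the expected price of the complete protocol. -/
lemma value_initConfig_le (w : Pricing m) (M : Fin (m + 1) → VNMeasurement) (t : ℕ) :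
    value w M t (ghzProtocol m).initConfig ≤ bernValue w M 1 0 :=
  (stageBounds w M t).bern 1 0 le_rfl le_rfl (by norm_num)

end Stages

/-! ### The expected numbers of rounds -/

lemma ENNReal.tsum_le_of_le_geometric {a : ℕ → ℝ≥0∞} (N : ℕ) (c : ℝ≥0∞) (h1 : ∀ d, a d ≤ 1)
    (h2 : ∀ d, N ≤ d → a d ≤ c * 2⁻¹ ^ d) : ∑' d, a d ≤ N + c * 2⁻¹ ^ N * 2 := by
  rw [← Summable.sum_add_tsum_nat_add' (k := N) ENNReal.summable]
  refine add_le_add ?_ ?_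
  · refine (Finset.sum_le_sum fun d _ => h1 d).trans ?_
    simp
  · refine (ENNReal.tsum_le_tsum fun d => h2 (d + N) (Nat.le_add_left N d)).trans (le_of_eq ?_)
    simp only [pow_add, mul_comm c]
    rw [ENNReal.tsum_mul_right, ENNReal.tsum_mul_right, ENNReal.tsum_geometric,
      ENNReal.one_sub_inv_two, inv_inv]
    ring

section Rounds

variable {m : ℕ}

/-- Undecided values lie in an open interval of length 3 · 2⁻ᵏ, which contains at most three grid
points. -/
lemma goProb_bernGo_le (M : Fin (m + 1) → VNMeasurement) (d : ℕ) :
    goProb (bernGo M) (d + 1) 1 0 ≤ 3 * 2⁻¹ ^ (d + 1) := by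
  classical
  refine (goProb_le_count _ d 1 0).trans ?_
  rw [ENNReal.div_eq_inv_mul, ENNReal.inv_pow, mul_comm]
  gcongr
  have h := card_le_of_sub_le ((Finset.range (2 ^ (d + 1))).filter
    fun j : ℕ => bernGo M (1 + d) (0 + j / 2 ^ (1 + d))) 2 ?_
  · exact_mod_cast h
  · intro i hi j hj
    have hi' := (Finset.mem_filter.1 hi).2.1
    have hj' := (Finset.mem_filter.1 hj).2.2
    have ht : (0 : ℝ) < 2 ^ (1 + d) := by positivity
    simp only [bernYes, bernNo, zero_add, not_le, ge_iff_le] at hi' hj'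
    have h3 : (j : ℝ) / 2 ^ (1 + d) < (i + 3) / 2 ^ (1 + d) := by
      rw [add_div]
      have : (3 : ℝ) / 2 ^ (1 + d) = 2 / 2 ^ (1 + d) + 1 / 2 ^ (1 + d) := by ring
      linarith
    rw [div_lt_div_iff_of_pos_right ht] at h3
    have h4 : j < i + 3 := by exact_mod_cast h3
    omega

lemma loopRounds_bernGo_le (M : Fin (m + 1) → VNMeasurement) :
    loopRounds (bernGo M) 1 0 ≤ 7 / 2 := by
  -- Cutting after two rounds gives 2 + 3 · (1/4) · 2 = 7/2.
  refine (ENNReal.tsum_le_of_le_geometric 2 3 (fun d => goProb_le_one _ _ _ _)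
    fun d hd => ?_).trans (le_of_eq ?_)
  · obtain ⟨d, rfl⟩ := Nat.exists_eq_add_of_le' (show 1 ≤ d by omega)
    exact goProb_bernGo_le M d
  · rw [← ENNReal.toReal_eq_toReal_iff' (by finiteness) (by finiteness)]
    rw [ENNReal.toReal_add (by finiteness) (by finiteness)]
    simp
    norm_num

/-- An undecided `U` satisfies |U L - p| ≤ (4 + 1/2) 2⁻ᵏ, which leaves at most 9/L + 1 grid points.
L may be arbitrarily small, but the weight L/2 cancels it. -/
lemma envelope_mul_goProb_testGo_le (M : Fin (m + 1) → VNMeasurement) (B : Bool)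
    (x : Fin (m + 1) → ℤˣ) (d : ℕ) :
    ENNReal.ofReal (envelope M x / 2) * goProb (testGo M B x) (d + 1) 1 0 ≤
      ENNReal.ofReal (9 / 2 + envelope M x / 2) * 2⁻¹ ^ (d + 1) := by
  classical
  refine (mul_le_mul_right (goProb_le_count _ d 1 0) _).trans ?_
  rw [ENNReal.div_eq_inv_mul, ENNReal.inv_pow, mul_left_comm, mul_comm (2⁻¹ ^ (d + 1))]
  gcongr
  set s := (Finset.range (2 ^ (d + 1))).filter
    fun j : ℕ => testGo M B x (1 + d) (0 + j / 2 ^ (1 + d)) with hs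
  have hE := envelope_nonneg M x
  rw [← ENNReal.ofReal_natCast, ← ENNReal.ofReal_mul (by linarith)]
  refine ENNReal.ofReal_le_ofReal ?_
  rcases hE.eq_or_lt with hE0 | hE0
  · rw [← hE0]; norm_num
  have ht : (0 : ℝ) < 2 ^ (1 + d) := by positivity
  have hclose : ∀ i ∈ s, |(i : ℝ) / 2 ^ (1 + d) * envelope M x - branchProb M x B| ≤
      9 / 2 / 2 ^ (1 + d) := by
    intro i hi
    rw [hs, Finset.mem_filter, Finset.mem_range, zero_add] at hi
    have hU : (i : ℝ) / 2 ^ (1 + d) ∈ Set.Icc (0 : ℝ) 1 := by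
      refine ⟨by positivity, (div_le_one ht).2 ?_⟩
      rw [add_comm]
      exact_mod_cast hi.1.le
    have h1 := abs_le.1 (abs_testDiff_sub_le M B x (1 + d) hU)
    have h2 := not_lt.1 hi.2.1
    have h3 := not_lt.1 hi.2.2
    have h4 : (9 : ℝ) / 2 / 2 ^ (1 + d) = 4 / 2 ^ (1 + d) + 1 / 2 ^ (1 + d) / 2 := by ring
    rw [abs_le]
    constructor <;> linarith [h1.1, h1.2]
  have hcard := card_le_of_sub_le s ⌊9 / envelope M x⌋₊ fun i hi j hj => by
    have h1 := (abs_le.1 (hclose i hi)).1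
    have h2 := (abs_le.1 (hclose j hj)).2
    have h3 : ((j : ℝ) - i) * envelope M x / 2 ^ (1 + d) ≤ 9 / 2 ^ (1 + d) := by
      have h4 : ((j : ℝ) - i) * envelope M x / 2 ^ (1 + d) =
        (j : ℝ) / 2 ^ (1 + d) * envelope M x - i / 2 ^ (1 + d) * envelope M x := by ring
      have h5 : (9 : ℝ) / 2 ^ (1 + d) = 9 / 2 / 2 ^ (1 + d) + 9 / 2 / 2 ^ (1 + d) := by ring
      linarith
    rw [div_le_div_iff_of_pos_right ht, ← le_div_iff₀ hE0] at h3
    rcases le_total j i with h6 | h6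
    · omega
    · have h7 : j - i ≤ ⌊9 / envelope M x⌋₊ := Nat.le_floor (by rw [Nat.cast_sub h6]; exact h3)
      omega
  have hcard' : (s.card : ℝ) ≤ 9 / envelope M x + 1 := by
    have h8 := Nat.floor_le (show 0 ≤ 9 / envelope M x by positivity)
    have h9 : (s.card : ℝ) ≤ ⌊9 / envelope M x⌋₊ + 1 := by exact_mod_cast hcard
    linarith
  calc envelope M x / 2 * s.card ≤ envelope M x / 2 * (9 / envelope M x + 1) := by gcongr
    _ = 9 / 2 + envelope M x / 2 := by field_simp

lemma sum_envelope_mul_loopRounds_testGo_le (M : Fin (m + 1) → VNMeasurement) (B : Bool) :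
    ∑ x, ENNReal.ofReal (envelope M x / 2) * loopRounds (testGo M B x) 1 0 ≤ m + 21 / 4 := by
  simp only [loopRounds, ← ENNReal.tsum_mul_left]
  rw [← Summable.tsum_finsetSum fun _ _ => ENNReal.summable]
  -- The cut at `m + 4` balances the 2^(m+1) outcomes: the tail is 9/8 + 2^-(m+1)/4 ≤ 5/4, and 4 +
  -- 5/4 = 21/4.
  refine (ENNReal.tsum_le_of_le_geometric (m + 4) (ENNReal.ofReal (9 / 2 * 2 ^ (m + 1) + 1))
    (fun d => ?_) fun d hd => ?_).trans ?_
  · refine (Finset.sum_le_sum fun x _ => mul_le_mul_right (goProb_le_one _ _ _ _) _).trans ?_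
    simp only [mul_one, sum_ofReal_envelope, le_refl]
  · obtain ⟨d, rfl⟩ := Nat.exists_eq_add_of_le' (show 1 ≤ d by omega)
    refine (Finset.sum_le_sum fun x _ => envelope_mul_goProb_testGo_le M B x d).trans
      (le_of_eq ?_)
    rw [← Finset.sum_mul, ← ENNReal.ofReal_sum_of_nonneg
      fun x _ => by linarith [envelope_nonneg M x], Finset.sum_add_distrib, Finset.sum_const,
      ← Finset.sum_div, sum_envelope]
    simp [mul_comm]
  · have h : (m : ℝ) + 4 + (9 / 2 * 2 ^ (m + 1) + 1) * 2⁻¹ ^ (m + 4) * 2 ≤ m + 21 / 4 := by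
      have h1 : (2⁻¹ : ℝ) ^ (m + 4) = (2 ^ (m + 1))⁻¹ / 8 := by
        rw [inv_pow, show m + 4 = (m + 1) + 3 by ring, pow_add _ (m + 1) 3]; field_simp; norm_num
      have h2 : (2 : ℝ) ≤ 2 ^ (m + 1) := by
        rw [pow_succ]; linarith [one_le_pow₀ (M₀ := ℝ) one_le_two (n := m)]
      have h3 : (2 ^ (m + 1) : ℝ)⁻¹ ≤ 2⁻¹ := by gcongr
      have h4 : (2 : ℝ) ^ (m + 1) * (2 ^ (m + 1))⁻¹ = 1 := mul_inv_cancel₀ (by positivity)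
      rw [h1]
      have h5 : (9 / 2 * 2 ^ (m + 1) + 1) * ((2 ^ (m + 1) : ℝ)⁻¹ / 8) * 2 =
        9 / 8 * (2 ^ (m + 1) * (2 ^ (m + 1) : ℝ)⁻¹) + (2 ^ (m + 1) : ℝ)⁻¹ / 4 := by ring
      rw [h5, h4]
      linarith
    rw [← ENNReal.toReal_le_toReal (by finiteness) (by finiteness)]
    rw [ENNReal.toReal_add (by finiteness) (by finiteness),
      ENNReal.toReal_add (by finiteness) (by finiteness)]
    simp only [ENNReal.toReal_mul, ENNReal.toReal_pow, ENNReal.toReal_inv, ENNReal.toReal_ofNat,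
      ENNReal.toReal_natCast, ENNReal.toReal_div]
    rw [ENNReal.toReal_ofReal (by positivity)]
    push_cast
    exact h

end Rounds

lemma mix_le {p : ℝ} (hp : p ∈ Set.Icc (0 : ℝ) 1) {A B C : ℝ≥0∞} (hA : A ≤ C) (hB : B ≤ C) :
    mix p A B ≤ C := by
  calc mix p A B ≤ ENNReal.ofReal p * C + ENNReal.ofReal (1 - p) * C :=
        add_le_add (mul_le_mul_right hA _) (mul_le_mul_right hB _)
    _ = C := by
        rw [← add_mul, ← ENNReal.ofReal_add hp.1 (by linarith [hp.2])]; simp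

/-! ### Expected numbers of coins and bits -/

section Bounds

open Protocol

variable {m : ℕ}

/-- The bound for the expected price of the protocol when outputs are not rewarded. -/
def priceBound (w : Pricing m) : ℝ≥0∞ :=
  2 * (trialCost w + testCost w * (m + 21 / 4)) + bernCost w * (7 / 2) + bernSetup w

lemma bernValue_le (w : Pricing m) (M : Fin (m + 1) → VNMeasurement) (hw : w.reward = 0) :
    bernValue w M 1 0 ≤ priceBound w := by
  have hT : ∀ B, trialValue w M B ≤ 2 * (trialCost w + testCost w * (m + 21 / 4)) := by
    intro B
    rw [trialValue]
    gcongr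
    simp only [hw, Pi.zero_apply, mul_zero, add_zero, mul_left_comm _ (testCost w)]
    rw [← Finset.mul_sum]
    gcongr
    exact sum_envelope_mul_loopRounds_testGo_le M B
  rw [bernValue, loopValue, if_pos rfl, priceBound]
  gcongr
  · exact mix_le (below_mem _ _ _) (hT true) (hT false)
  · exact loopRounds_bernGo_le M

lemma expectedCoins_eq (π : Protocol m) (M : Fin (m + 1) → VNMeasurement) :
    π.expectedCoins M =
      ∑' t, π.expect M t fun c => price (π := π) ⟨1, 0, 0, 0⟩ (π.nextEvent M c) := by
  have h : ∀ e : Event π.Config, e.coins = price ⟨1, 0, 0, 0⟩ e := by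
    intro e; cases e <;> simp [price, Event.coins]
  simp only [expectedCoins, expect, h]

lemma expectedBits_eq (π : Protocol m) (M : Fin (m + 1) → VNMeasurement) :
    π.expectedBits M =
      ∑' t, π.expect M t fun c => price (π := π) ⟨0, 1, 0, 0⟩ (π.nextEvent M c) := by
  have h : ∀ e : Event π.Config, e.bits = price ⟨0, 1, 0, 0⟩ e := by
    intro e; cases e <;> simp [price, Event.bits]
  simp only [expectedBits, expect, h]

lemma tsum_expect_price_le (w : Pricing m) (M : Fin (m + 1) → VNMeasurement)
    (hw : w.reward = 0) :
    ∑' t, (ghzProtocol m).expect M t (fun c => price w ((ghzProtocol m).nextEvent M c)) ≤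
      priceBound w := by
  refine ENNReal.tsum_le_of_sum_range_le fun n => ?_
  refine (le_self_add.trans (sum_expect_price w n).le).trans ?_
  exact (value_initConfig_le w M n).trans (bernValue_le w M hw)

lemma logParties_le (m : ℕ) : logParties m ≤ m :=
  Nat.clog_le_of_le_pow (Nat.lt_two_pow_self (n := m))

/-- A trial uses 1 coin for `S`, 2 for each of the `m + 1` signs and at most `m + 21/4` for the test
on average. Two trials are expected and the bit `B` needs at most 7/2, so the total is 2(3m + 33/4)
+ 7/2 = 6(m + 1) + 14. -/
lemma expectedCoins_le (M : Fin (m + 1) → VNMeasurement) :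
    (ghzProtocol m).expectedCoins M ≤ 6 * ((m : ℝ≥0∞) + 1) + 14 := by
  rw [expectedCoins_eq]
  refine (tsum_expect_price_le _ M rfl).trans (le_of_eq ?_)
  simp only [priceBound, trialCost, testCost, bernCost, bernSetup, testSetup, dealCost, mul_zero,
    add_zero, mul_one, one_mul]
  rw [← ENNReal.toReal_eq_toReal_iff' (by finiteness) (by finiteness)]
  repeat rw [ENNReal.toReal_add (by finiteness) (by finiteness)]
  simp only [ENNReal.toReal_mul]
  repeat rw [ENNReal.toReal_add (by finiteness) (by finiteness)]
  simp only [ENNReal.toReal_mul, ENNReal.toReal_div, ENNReal.toReal_ofNat, ENNReal.toReal_natCast,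
    ENNReal.toReal_one]
  ring

lemma expectedBits_le (M : Fin (m + 1) → VNMeasurement) :
    (ghzProtocol m).expectedBits M ≤ 100 * ((m : ℝ≥0∞) + 1) ^ 2 := by
  rw [expectedBits_eq]
  refine (tsum_expect_price_le _ M rfl).trans ?_
  simp only [priceBound, trialCost, testCost, bernCost, bernSetup, testSetup, dealCost, mul_zero,
    add_zero, zero_add, mul_one]
  have h1 : (21 / 4 : ℝ≥0∞) ≤ 6 := ENNReal.div_le_of_le_mul (by norm_num)
  have h2 : (7 / 2 : ℝ≥0∞) ≤ 4 := ENNReal.div_le_of_le_mul (by norm_num)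
  -- This crude bound is enough: the setup then costs O(m²), no more than the rounds of the test.
  have h3 := logParties_le m
  have h4 : ampExtra m ≤ 4 + m := by unfold ampExtra; omega
  have h5 : angleExtra m ≤ 3 + m := by unfold angleExtra; omega
  calc _ ≤ 2 * ((m : ℝ≥0∞) + 2 * 2 * m + m * (2 * ((4 + m : ℕ) : ℝ≥0∞)) + m +
        m * 3 * (m + 6)) + m * 2 * 4 + m * ((3 + m : ℕ) : ℝ≥0∞) := by gcongr
    _ ≤ _ := by
      have h : 2 * (m + 2 * 2 * m + m * (2 * (4 + m)) + m + m * 3 * (m + 6)) + m * 2 * 4 +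
        m * (3 + m) ≤ 100 * (m + 1) ^ 2 := by nlinarith
      exact_mod_cast h

end Bounds

/-! ### The law of the outputs -/

namespace Protocol

variable {m : ℕ} {π : Protocol m} {M : Fin (m + 1) → VNMeasurement}

lemma eq_of_act_eq_silent {c c' : π.Config} (h : π.act c = .silent c') : c' = c := by
  unfold act at h
  split at h
  · cases h; rfl
  · cases h
  · split at h <;> cases h; rfl
  · split at h <;> cases h; rfl

open Classical in
-- A silent step leaves the refreshed configuration as it is, and refreshing creates no outputs; so
-- a free step occurs only after halting.
lemma Delayed.one_le_price (hπ : π.Delayed) (c : π.Config) :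
    (if ∃ x, π.Outputs c x then 0 else 1) ≤ price (π := π) ⟨1, 1, 1, 0⟩ (π.nextEvent M c) := by
  cases h : π.nextEvent M c with
  | coin k => rw [price]; split_ifs <;> simp
  | bit c' => rw [price]; split_ifs <;> simp
  | silent c' =>
    rw [price]
    have h' := eq_of_act_eq_silent h
    subst h'
    by_cases hx : ∃ x, π.Outputs (π.refresh M c) x
    · obtain ⟨x, hx⟩ := hx
      rw [if_pos ⟨x, hπ.outputs_of_refresh hx⟩]
      exact zero_le
    · rw [if_neg hx]
      split_ifs <;> simp

lemma expect_sum {ι : Type} (s : Finset ι) (t : ℕ) (h : ι → π.Config → ℝ≥0∞) :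
    π.expect M t (fun c => ∑ i ∈ s, h i c) = ∑ i ∈ s, π.expect M t (h i) := by
  simp only [expect, Finset.mul_sum]
  exact Summable.tsum_finsetSum fun _ _ => ENNReal.summable

/-- A protocol with a finite expected number of steps halts with probability one. -/
lemma Delayed.one_le_sum_outputProb (hπ : π.Delayed)
    (h : ∑' t, π.expect M t (fun c => price (π := π) ⟨1, 1, 1, 0⟩ (π.nextEvent M c)) ≠ ⊤) :
    1 ≤ ∑ x, π.outputProb M x := by
  classical
  set go : π.Config → ℝ≥0∞ := fun c => if ∃ x, π.Outputs c x then 0 else 1 with hgo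
  have hlim : Filter.Tendsto (fun t => π.expect M t go) Filter.atTop (nhds 0) := by
    refine ENNReal.tendsto_atTop_zero_of_tsum_ne_top (ne_top_of_le_ne_top h ?_)
    exact ENNReal.tsum_le_tsum fun t => expect_mono t hπ.one_le_price
  -- At any time either some output has been reached or the protocol is still running. The
  -- probability of the latter is a term of a convergent series and tends to 0.
  have hone : ∀ t, 1 ≤ ∑ x, π.outputProb M x + π.expect M t go := by
    intro t
    have h1 : ∀ c : π.Config, (1 : ℝ≥0∞) =
        (∑ x, Set.indicator {c | π.Outputs c x} 1 c) + go c := by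
      intro c
      by_cases hc : ∃ x, π.Outputs c x
      · obtain ⟨x, hx⟩ := hc
        rw [Finset.sum_eq_single x]
        · simp only [hgo]
          rw [if_pos ⟨x, hx⟩]
          simp [hx]
        · intro y _ hy
          exact Set.indicator_of_notMem (fun h => hy (h.unique hx)) _
        · simp
      · simp only [hgo, if_neg hc]
        have h0 : ∑ x, Set.indicator {c | π.Outputs c x} (1 : π.Config → ℝ≥0∞) c = 0 :=
          Finset.sum_eq_zero fun x _ => Set.indicator_of_notMem
            (show c ∉ {c | π.Outputs c x} from fun h => hc ⟨x, h⟩) _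
        rw [h0, zero_add]
    rw [← expect_one (π := π) (M := M) t, funext h1, expect_add, expect_sum]
    gcongr with x
    rw [← toOuterMeasure_run]
    exact le_iSup (fun t => (π.run M t).toOuterMeasure {c | π.Outputs c x}) t
  have h2 := ge_of_tendsto' (hlim.const_add (∑ x, π.outputProb M x)) hone
  rwa [add_zero] at h2

lemma outputProb_le_of_value_le {x : Fin (m + 1) → ℤˣ} {b : ℝ≥0∞}
    (h : ∀ t, value ⟨0, 0, 0, Pi.single x 1⟩ M t π.initConfig ≤ b) : π.outputProb M x ≤ b := by
  classical
  refine iSup_le fun t => ?_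
  refine le_trans ?_ (h t)
  rw [toOuterMeasure_run, ← sum_expect_price]
  refine le_add_left (expect_mono t fun c => ?_)
  by_cases hc : π.Outputs c x
  · rw [payoff_of_outputs _ hc, Set.indicator_of_mem (show c ∈ {c | π.Outputs c x} from hc)]
    simp
  · rw [Set.indicator_of_notMem (show c ∉ {c | π.Outputs c x} from hc)]
    exact zero_le

end Protocol

/-! ### Identification of the output law -/

section Outputs

open Protocol

variable {m : ℕ}

/-- With free steps only the term of `x` survives: 2 · (L/2) · (p_B/L) = p_B. -/
lemma trialValue_single (M : Fin (m + 1) → VNMeasurement) (B : Bool) (x : Fin (m + 1) → ℤˣ) :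
    trialValue ⟨0, 0, 0, Pi.single x 1⟩ M B = ENNReal.ofReal (branchProb M x B) := by
  rw [trialValue]
  simp only [trialCost, testCost, testSetup, dealCost, mul_zero, add_zero, zero_mul, zero_add]
  rw [Finset.sum_eq_single x]
  · rw [← mul_assoc (ENNReal.ofReal _), ofReal_envelope_mul_acceptProb, Pi.single_eq_same, mul_one,
      ENNReal.ofReal_div_of_pos two_pos, ENNReal.ofReal_ofNat,
      ENNReal.mul_div_cancel (by simp) (by simp)]
  · intro y _ hy
    rw [Pi.single_eq_of_ne hy, mul_zero, mul_zero]
  · simp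

lemma bernValue_single (M : Fin (m + 1) → VNMeasurement) (x : Fin (m + 1) → ℤˣ) :
    bernValue ⟨0, 0, 0, Pi.single x 1⟩ M 1 0 = ENNReal.ofReal (ghzProb M x) := by
  have hp := branchParam_mem M
  have h1 : 0 ≤ 1 - branchParam M := by linarith [hp.2]
  rw [bernValue, loopValue, trialValue_single, trialValue_single, below_start hp, ghzProb_eq_mix,
    ENNReal.ofReal_add (mul_nonneg hp.1 (branchProb_nonneg M x _))
      (mul_nonneg h1 (branchProb_nonneg M x _)),
    ENNReal.ofReal_mul hp.1, ENNReal.ofReal_mul h1]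
  simp [bernCost, bernSetup, mix]

lemma outputProb_le (M : Fin (m + 1) → VNMeasurement) (x : Fin (m + 1) → ℤˣ) :
    (ghzProtocol m).outputProb M x ≤ ENNReal.ofReal (ghzProb M x) :=
  outputProb_le_of_value_le fun t => (bernValue_single M x).symm ▸ value_initConfig_le _ M t

lemma sum_ofReal_ghzProb (M : Fin (m + 1) → VNMeasurement) :
    ∑ x, ENNReal.ofReal (ghzProb M x) = 1 := by
  rw [← ENNReal.ofReal_sum_of_nonneg fun x _ => ghzProb_nonneg M x,
    sum_ghzProb M (Nat.succ_ne_zero m), ENNReal.ofReal_one]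

lemma one_le_sum_outputProb (M : Fin (m + 1) → VNMeasurement) :
    1 ≤ ∑ x, (ghzProtocol m).outputProb M x := by
  -- Every coin, bit and idle step costs 1 here, so a finite price bounds the expected number of
  -- steps before halting.
  refine (ghzProtocol_delayed m).one_le_sum_outputProb
    (ne_top_of_le_ne_top ?_ (tsum_expect_price_le ⟨1, 1, 1, 0⟩ M rfl))
  simp only [priceBound, trialCost, testCost, bernCost, bernSetup, testSetup, dealCost]
  finiteness

/-- The upper bounds have total mass 1 and the output probabilities at least 1, so a deficit at `x`
could not be made up elsewhere. -/
lemma outputProb_eq (M : Fin (m + 1) → VNMeasurement) (x : Fin (m + 1) → ℤˣ) :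
    (ghzProtocol m).outputProb M x = ENNReal.ofReal (ghzProb M x) := by
  classical
  refine le_antisymm (outputProb_le M x) ?_
  have h1 := (sum_ofReal_ghzProb M).le.trans (one_le_sum_outputProb M)
  rw [← Finset.add_sum_erase _ _ (Finset.mem_univ x),
    ← Finset.add_sum_erase _ _ (Finset.mem_univ x)] at h1
  have h2 : ∑ y ∈ Finset.univ.erase x, ENNReal.ofReal (ghzProb M y) ≠ ⊤ := by
    simp [ENNReal.sum_eq_top]
  exact ENNReal.le_of_add_le_add_right h2
    (h1.trans (add_le_add le_rfl (Finset.sum_le_sum fun y _ => outputProb_le M y)))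

end Outputs

end

theorem mainTheorem1 :
    (∀ (m : ℕ) (M : Fin (m + 1) → VNMeasurement),
      (∀ x : Fin (m + 1) → ℤˣ,
        (ghzProtocol m).outputProb M x = ENNReal.ofReal (ghzProb M x)) ∧
      (∑ x : Fin (m + 1) → ℤˣ, (ghzProtocol m).outputProb M x) = 1 ∧
      (ghzProtocol m).expectedCoins M ≤ 6 * ((m : ENNReal) + 1) + 14) ∧
    ∃ C : NNReal, ∀ (m : ℕ) (M : Fin (m + 1) → VNMeasurement),
      (ghzProtocol m).expectedBits M ≤ (C : ENNReal) * ((m : ENNReal) + 1) ^ 2 := by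
  refine ⟨fun m M => ⟨outputProb_eq M, ?_, expectedCoins_le M⟩, 100, fun m M => ?_⟩
  · simp only [outputProb_eq, sum_ofReal_ghzProb]
  · exact_mod_cast expectedBits_le M
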